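/- Let $d\ge 1$, $T>0$, $H\in(1/4,1)$, and let $X=(X_t)_{t\ge 0}$ be a $d$-dimensional fractional Brownian motion with Hurst index $H$, i.e. an $\mathbb{R}^d$-valued process whose components $X^1,\dots,X^d$ are independent, continuous, centred real Gaussian processes with covariance $\operatorname{Cov}(X^i_s,X^i_t)=\frac12\big(s^{2H}+t^{2H}-|t-s|^{2H}\big)$, $s,t\ge 0$. For $\alpha>0$ let $$K_\alpha(x)=\frac{1}{\Gamma(\alpha)(4\pi)^{d/2}}\int_0^\infty t^{\alpha-\frac d2}\,e^{-\frac{|x|^2}{4t}-t}\,\frac{dt}{t},\qquad x\in\mathbb{R}^d,$$ be the kernel of $(1-\Delta)^{-\alpha}$ on $\mathbb{R}^d$. For $\varepsilon>0$ and $t\ge0$ put $$D^0_\varepsilon X_t=\frac{X_{t+\varepsilon}-X_{t-\varepsilon}}{2\varepsilon}\quad(\text{with } X_u=0 \text{ for } u<0),\qquad Z_{\alpha,\varepsilon}=\int_0^T\!\!\int_0^T K_\alpha(X_t-X_s)\,\langle D^0_\varepsilon X_t,D^0_\varepsilon X_s\rangle\,dt\,ds .$$ Let $\alpha_H=\frac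 d2-1+\frac1{2H}$ (which is positive). Then, for every $\alpha>\alpha_H$: for each $\varepsilon>0$ the integrand of $Z_{\alpha,\varepsilon}$ is almost surely Lebesgue integrable on $[0,T]^2$, the random variable $Z_{\alpha,\varepsilon}$ is integrable, and $$\sup_{\varepsilon>0} E\,[Z_{\alpha,\varepsilon}]<\infty .$$ -/

import Mathlib

open MeasureTheory ProbabilityTheory Set
open scoped NNReal

noncomputable section

/-- A (real) fractional Brownian motion with Hurst index `H` on `[0, ∞)`: a continuous centred
Gaussian process with covariance `(s ^ (2H) + t ^ (2H) - |s - t| ^ (2H)) / 2`. -/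
structure IsFBM {Ω : Type*} [MeasurableSpace Ω] (H : ℝ) (B : ℝ≥0 → Ω → ℝ) (P : Measure Ω) :
    Prop where
  measurable : ∀ t, Measurable (B t)
  gaussian : IsGaussianProcess B P
  mean_zero : ∀ t, ∫ ω, B t ω ∂P = 0
  covariance_eq : ∀ s t : ℝ≥0, covariance (B s) (B t) P =
    (1 / 2) * ((s : ℝ) ^ (2 * H) + (t : ℝ) ^ (2 * H) - |(s : ℝ) - (t : ℝ)| ^ (2 * H))
  continuous_paths : ∀ᵐ ω ∂P, Continuous fun t ↦ B t ω

/-- A `d`-dimensional fractional Brownian motion with Hurst index `H`: its components are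
independent (as processes) real fractional Brownian motions with Hurst index `H`. -/
structure IsFBMVec {Ω : Type*} [MeasurableSpace Ω] (d : ℕ) (H : ℝ)
    (X : ℝ≥0 → Ω → EuclideanSpace ℝ (Fin d)) (P : Measure Ω) : Prop where
  isFBM : ∀ i : Fin d, IsFBM H (fun t ω ↦ X t ω i) P
  indep : iIndepFun (fun (i : Fin d) (ω : Ω) (t : ℝ≥0) ↦ X t ω i) P

/-- The kernel `K_α` of `(1 - Δ) ^ (-α)` on `ℝᵈ`,
`K_α(x) = (Γ(α) (4π) ^ (d/2))⁻¹ ∫₀^∞ t ^ (α - d/2) exp (-|x|² / (4t) - t) dt / t`.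
(For `0 < α ≤ d/2` the integral diverges at `x = 0`, and the value there is set to `0`.) -/
def besselKernel (d : ℕ) (α : ℝ) (x : EuclideanSpace ℝ (Fin d)) : ℝ :=
  (Real.Gamma α * (4 * Real.pi) ^ ((d : ℝ) / 2))⁻¹ *
    ∫ t in Ioi (0 : ℝ), t ^ (α - (d : ℝ) / 2) * Real.exp (-‖x‖ ^ 2 / (4 * t) - t) / t

/-- A path on `[0, ∞)`, extended by `0` to negative times. -/
def extendByZero {E : Type*} [Zero E] (x : ℝ≥0 → E) (t : ℝ) : E :=
  if 0 ≤ t then x t.toNNReal else 0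

/-- The symmetric difference quotient `D⁰_ε x_t = (x_{t+ε} - x_{t-ε}) / (2ε)` of a path. -/
def symmDiffQuot {d : ℕ} (x : ℝ≥0 → EuclideanSpace ℝ (Fin d)) (ε t : ℝ) :
    EuclideanSpace ℝ (Fin d) :=
  (2 * ε)⁻¹ • (extendByZero x (t + ε) - extendByZero x (t - ε))

/-- The integrand `(t, s) ↦ K_α(x_t - x_s) ⟨D⁰_ε x_t, D⁰_ε x_s⟩`. -/
def symmEnergyIntegrand {d : ℕ} (α ε : ℝ) (x : ℝ≥0 → EuclideanSpace ℝ (Fin d)) (p : ℝ × ℝ) : ℝ :=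
  besselKernel d α (extendByZero x p.1 - extendByZero x p.2) *
    inner ℝ (symmDiffQuot x ε p.1) (symmDiffQuot x ε p.2)

/-- `Z_{α,ε} = ∫₀ᵀ ∫₀ᵀ K_α(x_t - x_s) ⟨D⁰_ε x_t, D⁰_ε x_s⟩ dt ds`. -/
def symmEnergy {d : ℕ} (T α ε : ℝ) (x : ℝ≥0 → EuclideanSpace ℝ (Fin d)) : ℝ :=
  ∫ p in Icc (0 : ℝ) T ×ˢ Icc (0 : ℝ) T, symmEnergyIntegrand α ε x p

end

/-! Put p = 2H and u = |t - s|. The Bessel kernel is a mixture of the Gaussians exp(-|x|²/(4r)) with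
weight w(r) = r^(α - d/2 - 1) e^(-r), so the mean of the energy reduces to explicit Gaussian
integrals. Regression on X_t - X_s gives, with x = u^p/(2r), the mean d (1+x)^(-d/2) (γ + κ u^(-p)
x/(1+x)). Here γ is the covariance of the two difference quotients (`quotCov`), and κ is the product
of their covariances with the increment between s and t, each oriented towards its own time
(`quotIncrCov`).

Uniformly in ε, |γ| ≤ 4 u^(p-2), and the factors of κ are O(u^(p-1)), up to a boundary term t^(p-1)
or s^(p-1) when p < 1. Near the diagonal this is not integrable for p ≤ 1, so cancellation is
needed: (1+x)^(-d/2) is replaced by (1+x)^(-d/2) - c with c = 1 if p ≤ 1 and c = 0 if p > 1. Both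
this difference and (1+x)^(-d/2) x/(1+x) are O(x^θ), which gains u^(pθ) and costs r^(-θ). The former
restores integrability in (t, s) if pθ > 1 - p; the latter is integrable against w if θ < α - d/2.
The hypothesis α > α_H says exactly that 1/p - 1 < α - d/2, so such a θ exists
(`exists_comparison_exponent`); H > 1/4 allows θ < 1 and makes the squared boundary terms
integrable.

The subtracted part is c d times the double integral of γ times the integral of w. Since γ is a
second-order difference of the covariance function divided by 4ε², its double integral telescopes to
boundary windows of length 2ε and stays bounded (`IncrCovBound.abs_integral_quotCov_le`), although γ
has no integrable majorant uniform in ε. -/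

noncomputable section

/-! ### Gaussian integrals with the weight exp(-l U²) -/

theorem integral_exp_neg_mul_sq_mul_gaussianReal {v : ℝ≥0} (hv : v ≠ 0) {l : ℝ} (hl : 0 ≤ l)
    (f : ℝ → ℝ) :
    ∫ x, Real.exp (-l * x ^ 2) * f x ∂(gaussianReal 0 v) =
      (1 + 2 * l * v) ^ (-(1 / 2) : ℝ) *
        ∫ x, f x ∂(gaussianReal 0 (v / (1 + 2 * l.toNNReal * v))) := by
  have hv0 : (0 : ℝ) < v := by positivity
  have hpos : (0 : ℝ) < 1 + 2 * l * v := by positivity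
  have hv' : v / (1 + 2 * l.toNNReal * v) ≠ 0 := by positivity
  rw [integral_gaussianReal_eq_integral_smul hv, integral_gaussianReal_eq_integral_smul hv',
    ← integral_const_mul]
  -- The tilt adds 2l to the inverse variance 1/v, so the densities agree pointwise up to the ratio
  -- of their normalisations.
  congr 1 with x
  simp only [gaussianPDFReal, smul_eq_mul, sub_zero, NNReal.coe_div, NNReal.coe_add,
    NNReal.coe_one, NNReal.coe_mul, NNReal.coe_ofNat, Real.coe_toNNReal l hl]
  have h1 : Real.sqrt (2 * Real.pi * (v / (1 + 2 * l * v))) =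
      Real.sqrt (2 * Real.pi * v) / Real.sqrt (1 + 2 * l * v) := by
    rw [← mul_div_assoc, Real.sqrt_div (by positivity)]
  have h2 : (1 + 2 * l * v : ℝ) ^ (-(1 / 2) : ℝ) = (Real.sqrt (1 + 2 * l * v))⁻¹ := by
    rw [Real.rpow_neg hpos.le, Real.sqrt_eq_rpow]
  have h3 : Real.exp (-x ^ 2 / (2 * (v / (1 + 2 * l * v)))) =
      Real.exp (-x ^ 2 / (2 * v)) * Real.exp (-l * x ^ 2) := by
    rw [← Real.exp_add]
    congr 1
    field_simp
    ring
  rw [h1, h2, h3]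
  have : Real.sqrt (1 + 2 * l * v) ≠ 0 := by positivity
  field_simp

theorem integral_exp_neg_mul_sq_gaussianReal {v : ℝ≥0} (hv : v ≠ 0) {l : ℝ} (hl : 0 ≤ l) :
    ∫ x, Real.exp (-l * x ^ 2) ∂(gaussianReal 0 v) = (1 + 2 * l * v) ^ (-(1 / 2) : ℝ) := by
  simpa using integral_exp_neg_mul_sq_mul_gaussianReal hv hl (fun _ ↦ 1)

theorem integral_exp_neg_mul_sq_mul_sq_gaussianReal {v : ℝ≥0} (hv : v ≠ 0) {l : ℝ}
    (hl : 0 ≤ l) :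
    ∫ x, Real.exp (-l * x ^ 2) * x ^ 2 ∂(gaussianReal 0 v) =
      (1 + 2 * l * v) ^ (-(1 / 2) : ℝ) * (v / (1 + 2 * l * v)) := by
  rw [integral_exp_neg_mul_sq_mul_gaussianReal hv hl]
  congr 1
  have h := variance_fun_id_gaussianReal (μ := 0) (v := v / (1 + 2 * l.toNNReal * v))
  rw [variance_eq_integral measurable_id'.aemeasurable] at h
  simp only [integral_id_gaussianReal, sub_zero] at h
  rw [h]
  simp [Real.coe_toNNReal l hl]

section Pair

variable {Ω : Type*} [MeasurableSpace Ω] {P : Measure Ω}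

theorem integral_add_const_mul_add_const_mul {f g h : Ω → ℝ} (hf : Integrable f P)
    (hg : Integrable g P) (hh : Integrable h P) (b c : ℝ) :
    ∫ ω, (f ω + b * g ω + c * h ω) ∂P = ∫ ω, f ω ∂P + b * ∫ ω, g ω ∂P + c * ∫ ω, h ω ∂P := by
  have h1 : Integrable (fun ω ↦ f ω + b * g ω) P := hf.add (hg.const_mul b)
  rw [integral_add h1 (hh.const_mul c), integral_add hf (hg.const_mul b), integral_const_mul,
    integral_const_mul]

theorem integrable_exp_neg_mul_sq_mul {U g : Ω → ℝ} (hU : AEMeasurable U P)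
    (hg : Integrable g P) {l : ℝ} (hl : 0 ≤ l) :
    Integrable (fun ω ↦ Real.exp (-l * U ω ^ 2) * g ω) P := by
  refine hg.bdd_mul (c := 1) ?_ ?_
  · exact (Real.measurable_exp.comp_aemeasurable
      ((hU.pow_const 2).const_mul _)).aestronglyMeasurable
  · refine ae_of_all _ fun ω ↦ ?_
    rw [Real.norm_eq_abs, abs_of_pos (Real.exp_pos _)]
    refine Real.exp_le_one_iff.2 ?_
    nlinarith [sq_nonneg (U ω)]

theorem HasGaussianLaw.integral_exp_neg_mul_sq {U : Ω → ℝ} (hU : HasGaussianLaw U P)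
    (hU0 : ∫ ω, U ω ∂P = 0) {v : ℝ} (hv : 0 < v) (hUv : ∫ ω, U ω ^ 2 ∂P = v) {l : ℝ}
    (hl : 0 ≤ l) :
    ∫ ω, Real.exp (-l * U ω ^ 2) ∂P = (1 + 2 * l * v) ^ (-(1 / 2) : ℝ) ∧
    ∫ ω, Real.exp (-l * U ω ^ 2) * U ω ^ 2 ∂P =
      (1 + 2 * l * v) ^ (-(1 / 2) : ℝ) * (v / (1 + 2 * l * v)) := by
  have hvar : Var[U; P] = v := by
    rw [variance_eq_integral hU.aemeasurable]
    simp [hU0, hUv]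
  have hmap := hU.map_eq_gaussianReal
  rw [hvar, hU0] at hmap
  have hv' : v.toNNReal ≠ 0 := by simpa using hv
  constructor
  · rw [← Real.coe_toNNReal v hv.le, ← integral_exp_neg_mul_sq_gaussianReal hv' hl, ← hmap,
      integral_map hU.aemeasurable (by fun_prop)]
  · have := integral_exp_neg_mul_sq_mul_sq_gaussianReal hv' hl
    rw [Real.coe_toNNReal v hv.le] at this
    rw [← this, ← hmap, integral_map hU.aemeasurable (by fun_prop)]

/-- Gaussian regression: the mean of `exp (-l U ^ 2) A ^ 2` for a centred Gaussian pair. -/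
theorem HasGaussianLaw.integral_exp_neg_mul_sq_mul_sq {U A : Ω → ℝ}
    (h : HasGaussianLaw (fun ω ↦ (U ω, A ω)) P) (hU0 : ∫ ω, U ω ∂P = 0)
    (hA0 : ∫ ω, A ω ∂P = 0) {v : ℝ} (hv : 0 < v) (hUv : ∫ ω, U ω ^ 2 ∂P = v) {l : ℝ}
    (hl : 0 ≤ l) :
    ∫ ω, Real.exp (-l * U ω ^ 2) * A ω ^ 2 ∂P = (1 + 2 * l * v) ^ (-(1 / 2) : ℝ) *
      (∫ ω, A ω ^ 2 ∂P - (∫ ω, A ω * U ω ∂P) ^ 2 * (2 * l / (1 + 2 * l * v))) := by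
  have := h.isProbabilityMeasure
  have hU : HasGaussianLaw U P := h.fst
  have hA : HasGaussianLaw A P := h.snd
  have hpos : (0 : ℝ) < 1 + 2 * l * v := by positivity
  set k := ∫ ω, A ω * U ω ∂P with hk
  -- The regression coefficient of A on U: the residual R is uncorrelated with U, hence independent
  -- of it by joint Gaussianity.
  set a := k / v with ha
  set R : Ω → ℝ := fun ω ↦ A ω - a * U ω with hR
  have hUR : HasGaussianLaw (fun ω ↦ (U ω, R ω)) P :=
    h.map_fun ((ContinuousLinearMap.fst ℝ ℝ ℝ).prod
      (ContinuousLinearMap.snd ℝ ℝ ℝ - a • ContinuousLinearMap.fst ℝ ℝ ℝ))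
  have iUU : Integrable (fun ω ↦ U ω ^ 2) P := hU.memLp_two.integrable_sq
  have iAA : Integrable (fun ω ↦ A ω ^ 2) P := hA.memLp_two.integrable_sq
  have iAU : Integrable (fun ω ↦ A ω * U ω) P := hA.memLp_two.integrable_mul hU.memLp_two
  have hRm : HasGaussianLaw R P := hUR.snd
  have iRR : Integrable (fun ω ↦ R ω ^ 2) P := hRm.memLp_two.integrable_sq
  have iUR : Integrable (fun ω ↦ U ω * R ω) P := hU.memLp_two.integrable_mul hRm.memLp_two
  have hR0 : ∫ ω, R ω ∂P = 0 := by
    rw [hR, integral_sub hA.integrable (hU.integrable.const_mul _), integral_const_mul, hU0, hA0]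
    simp
  have hcov : cov[U, R; P] = 0 := by
    rw [covariance_eq_sub hU.memLp_two hRm.memLp_two, hU0, zero_mul, sub_zero]
    have : (U * R) = fun ω ↦ A ω * U ω - a * U ω ^ 2 := by
      ext ω; simp only [hR, Pi.mul_apply]; ring
    rw [this, integral_sub iAU (iUU.const_mul _), integral_const_mul, hUv, ← hk, ha]
    field_simp
    ring
  have hind : IndepFun U R P := hUR.indepFun_of_covariance_eq_zero hcov
  have hRR : ∫ ω, R ω ^ 2 ∂P = ∫ ω, A ω ^ 2 ∂P - k ^ 2 / v := by
    have : (fun ω ↦ R ω ^ 2) = fun ω ↦ A ω ^ 2 + (-(2 * a)) * (A ω * U ω) + a ^ 2 * U ω ^ 2 := by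
      ext ω; simp only [hR]; ring
    rw [this, integral_add_const_mul_add_const_mul iAA iAU iUU, hUv, ← hk, ha]
    field_simp
    ring
  obtain ⟨e0, e2⟩ := HasGaussianLaw.integral_exp_neg_mul_sq hU hU0 hv hUv hl
  have m1 : ∫ ω, Real.exp (-l * U ω ^ 2) * R ω ^ 2 ∂P =
      (∫ ω, Real.exp (-l * U ω ^ 2) ∂P) * ∫ ω, R ω ^ 2 ∂P :=
    (hind.comp (φ := fun x ↦ Real.exp (-l * x ^ 2)) (ψ := fun x ↦ x ^ 2) (by fun_prop)
      (by fun_prop)).integral_fun_mul_eq_mul_integral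
      (by have := hU.aemeasurable; exact AEMeasurable.aestronglyMeasurable (by fun_prop))
      (by have := hRm.aemeasurable; exact AEMeasurable.aestronglyMeasurable (by fun_prop))
  have m2 : ∫ ω, Real.exp (-l * U ω ^ 2) * (U ω * R ω) ∂P = 0 := by
    have : ∫ ω, (Real.exp (-l * U ω ^ 2) * U ω) * R ω ∂P =
      (∫ ω, Real.exp (-l * U ω ^ 2) * U ω ∂P) * ∫ ω, R ω ∂P :=
      (hind.comp (φ := fun x ↦ Real.exp (-l * x ^ 2) * x) (ψ := fun x ↦ x) (by fun_prop)
        (by fun_prop)).integral_fun_mul_eq_mul_integral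
        (by have := hU.aemeasurable; exact AEMeasurable.aestronglyMeasurable (by fun_prop))
        (by have := hRm.aemeasurable; exact AEMeasurable.aestronglyMeasurable (by fun_prop))
    rw [hR0, mul_zero] at this
    rw [← this]
    congr 1 with ω
    ring
  have hdec : (fun ω ↦ Real.exp (-l * U ω ^ 2) * A ω ^ 2) = fun ω ↦
      Real.exp (-l * U ω ^ 2) * R ω ^ 2 + (2 * a) * (Real.exp (-l * U ω ^ 2) * (U ω * R ω)) +
        a ^ 2 * (Real.exp (-l * U ω ^ 2) * U ω ^ 2) := by
    ext ω; simp only [hR]; ring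
  have j1 := integrable_exp_neg_mul_sq_mul hU.aemeasurable iRR hl
  have j2 := integrable_exp_neg_mul_sq_mul hU.aemeasurable iUR hl
  have j3 := integrable_exp_neg_mul_sq_mul hU.aemeasurable iUU hl
  rw [hdec, integral_add_const_mul_add_const_mul j1 j2 j3, m1, m2, e0, e2, hRR, ha]
  field_simp
  ring

/-- Polarisation of the quadratic case, applied to A + B and A - B. -/
theorem HasGaussianLaw.integral_exp_neg_mul_sq_mul_mul {U A B : Ω → ℝ}
    (h : HasGaussianLaw (fun ω ↦ (U ω, A ω, B ω)) P) (hU0 : ∫ ω, U ω ∂P = 0)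
    (hA0 : ∫ ω, A ω ∂P = 0) (hB0 : ∫ ω, B ω ∂P = 0) {v : ℝ} (hv : 0 < v)
    (hUv : ∫ ω, U ω ^ 2 ∂P = v) {l : ℝ} (hl : 0 ≤ l) :
    ∫ ω, Real.exp (-l * U ω ^ 2) * (A ω * B ω) ∂P = (1 + 2 * l * v) ^ (-(1 / 2) : ℝ) *
      (∫ ω, A ω * B ω ∂P -
        (∫ ω, A ω * U ω ∂P) * (∫ ω, B ω * U ω ∂P) * (2 * l / (1 + 2 * l * v))) := by
  have := h.isProbabilityMeasure
  have hU : HasGaussianLaw U P := h.fst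
  have hA : HasGaussianLaw A P := h.snd.fst
  have hB : HasGaussianLaw B P := h.snd.snd
  have key : ∀ c : ℝ, ∫ ω, Real.exp (-l * U ω ^ 2) * (A ω + c * B ω) ^ 2 ∂P =
      (1 + 2 * l * v) ^ (-(1 / 2) : ℝ) * (∫ ω, (A ω + c * B ω) ^ 2 ∂P -
        (∫ ω, (A ω + c * B ω) * U ω ∂P) ^ 2 * (2 * l / (1 + 2 * l * v))) := by
    intro c
    refine HasGaussianLaw.integral_exp_neg_mul_sq_mul_sq ?_ hU0 ?_ hv hUv hl
    · exact h.map_fun ((ContinuousLinearMap.fst ℝ ℝ (ℝ × ℝ)).prod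
        ((ContinuousLinearMap.fst ℝ ℝ ℝ + c • ContinuousLinearMap.snd ℝ ℝ ℝ).comp
          (ContinuousLinearMap.snd ℝ ℝ (ℝ × ℝ))))
    · rw [integral_add hA.integrable (hB.integrable.const_mul _), integral_const_mul, hA0, hB0]
      simp
  have iAA : Integrable (fun ω ↦ A ω ^ 2) P := hA.memLp_two.integrable_sq
  have iBB : Integrable (fun ω ↦ B ω ^ 2) P := hB.memLp_two.integrable_sq
  have iAB : Integrable (fun ω ↦ A ω * B ω) P := hA.memLp_two.integrable_mul hB.memLp_two
  have iAU : Integrable (fun ω ↦ A ω * U ω) P := hA.memLp_two.integrable_mul hU.memLp_two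
  have iBU : Integrable (fun ω ↦ B ω * U ω) P := hB.memLp_two.integrable_mul hU.memLp_two
  have j1 := integrable_exp_neg_mul_sq_mul hU.aemeasurable iAA hl
  have j2 := integrable_exp_neg_mul_sq_mul hU.aemeasurable iAB hl
  have j3 := integrable_exp_neg_mul_sq_mul hU.aemeasurable iBB hl
  have s1 : ∀ c : ℝ, ∫ ω, Real.exp (-l * U ω ^ 2) * (A ω + c * B ω) ^ 2 ∂P =
      ∫ ω, Real.exp (-l * U ω ^ 2) * A ω ^ 2 ∂P +
      (2 * c) * ∫ ω, Real.exp (-l * U ω ^ 2) * (A ω * B ω) ∂P +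
      c ^ 2 * ∫ ω, Real.exp (-l * U ω ^ 2) * B ω ^ 2 ∂P := by
    intro c
    rw [← integral_add_const_mul_add_const_mul j1 j2 j3]
    congr 1 with ω
    ring
  have s2 : ∀ c : ℝ, ∫ ω, (A ω + c * B ω) ^ 2 ∂P =
      ∫ ω, A ω ^ 2 ∂P + (2 * c) * ∫ ω, A ω * B ω ∂P + c ^ 2 * ∫ ω, B ω ^ 2 ∂P := by
    intro c
    rw [← integral_add_const_mul_add_const_mul iAA iAB iBB]
    congr 1 with ω
    ring
  have s3 : ∀ c : ℝ, ∫ ω, (A ω + c * B ω) * U ω ∂P =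
      ∫ ω, A ω * U ω ∂P + c * ∫ ω, B ω * U ω ∂P := by
    intro c
    rw [← integral_const_mul, ← integral_add iAU (iBU.const_mul _)]
    congr 1 with ω
    ring
  have k1 := key 1
  have k2 := key (-1)
  rw [s1, s2, s3] at k1 k2
  linear_combination (k1 - k2) / 4

end Pair

/-! ### Covariances of increments and of difference quotients -/

/-- The covariance of the increments of a fractional Brownian motion with Hurst index `p / 2`
over `[a, b]` and `[c, d]`. -/
def incrCov (p a b c d : ℝ) : ℝ :=
  (|b - c| ^ p + |a - d| ^ p - |b - d| ^ p - |a - c| ^ p) / 2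

theorem incrCov_comm (p a b c d : ℝ) : incrCov p a b c d = incrCov p c d a b := by
  unfold incrCov
  rw [abs_sub_comm b c, abs_sub_comm a d, abs_sub_comm b d, abs_sub_comm a c]
  ring

theorem incrCov_swap_right (p a b c d : ℝ) : incrCov p a b c d = -incrCov p a b d c := by
  unfold incrCov
  ring

theorem rpow_le_of_half_le {q m x : ℝ} (hm : 0 < m) (h1 : m / 2 ≤ x) (h2 : x ≤ 2 * m)
    {n : ℝ} (hq1 : -n ≤ q) (hq2 : q ≤ n) : x ^ q ≤ 2 ^ n * m ^ q := by
  have hx : 0 < x := by linarith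
  rcases le_total 0 q with hq | hq
  · calc x ^ q ≤ (2 * m) ^ q := Real.rpow_le_rpow hx.le h2 hq
      _ = 2 ^ q * m ^ q := Real.mul_rpow (by norm_num) hm.le
      _ ≤ 2 ^ n * m ^ q := by
        gcongr
        norm_num
  · calc x ^ q ≤ (m / 2) ^ q := Real.rpow_le_rpow_of_nonpos (by linarith) h1 hq
      _ = 2 ^ (-q) * m ^ q := by
        rw [Real.div_rpow hm.le (by norm_num), Real.rpow_neg (by norm_num)]
        field_simp
      _ ≤ 2 ^ n * m ^ q := by
        gcongr
        · norm_num
        · linarith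

theorem abs_rpow_sub_rpow_le {q m y z : ℝ} (hm : 0 < m) {n : ℝ} (hq1 : -n ≤ q - 1)
    (hq2 : q - 1 ≤ n) (hy1 : m / 2 ≤ y) (hy2 : y ≤ 2 * m) (hz1 : m / 2 ≤ z) (hz2 : z ≤ 2 * m) :
    |z ^ q - y ^ q| ≤ |q| * 2 ^ n * m ^ (q - 1) * |z - y| := by
  refine (convex_Icc (m / 2) (2 * m)).norm_image_sub_le_of_norm_hasDerivWithin_le
    (f := fun x ↦ x ^ q) (f' := fun x ↦ q * x ^ (q - 1)) (C := |q| * 2 ^ n * m ^ (q - 1))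
    (fun x hx ↦ ?_) (fun x hx ↦ ?_) ⟨hy1, hy2⟩ ⟨hz1, hz2⟩
  · have : x ≠ 0 := by have := hx.1; intro h; linarith
    exact (Real.hasDerivAt_rpow_const (Or.inl this)).hasDerivWithinAt
  · have hx0 : 0 < x := by have := hx.1; linarith
    rw [Real.norm_eq_abs, abs_mul, abs_of_pos (Real.rpow_pos_of_pos hx0 _), mul_assoc]
    exact mul_le_mul_of_nonneg_left (rpow_le_of_half_le hm hx.1 hx.2 hq1 hq2) (abs_nonneg _)

/-- The mean value inequality, used twice. The 8 is 2 · 4: p|p - 1| ≤ 2, and y^(p-2) ≤ 4 m^(p-2) for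
y between m/2 and 2m. -/
theorem abs_rpow_second_difference_le {p m x h k : ℝ} (hp : 0 < p) (hp2 : p ≤ 2) (hm : 0 < m)
    (hh : 0 ≤ h) (hk : 0 ≤ k) (hx1 : m / 2 ≤ x) (hx2 : x + h + k ≤ 2 * m) :
    |(x + k + h) ^ p - (x + k) ^ p - ((x + h) ^ p - x ^ p)| ≤ 8 * h * k * m ^ (p - 2) := by
  have key := (convex_Icc x (x + k)).norm_image_sub_le_of_norm_hasDerivWithin_le
    (f := fun y ↦ (y + h) ^ p - y ^ p) (f' := fun y ↦ p * (y + h) ^ (p - 1) - p * y ^ (p - 1))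
    (C := 8 * h * m ^ (p - 2)) (x := x) (y := x + k)
    (fun y hy ↦ ?_) (fun y hy ↦ ?_) ⟨le_rfl, by linarith⟩ ⟨by linarith, le_rfl⟩
  · rw [Real.norm_eq_abs, Real.norm_eq_abs, add_sub_cancel_left, abs_of_nonneg hk] at key
    linarith
  · have h1 : y ≠ 0 := by have := hy.1; intro h; linarith
    have h2 : y + h ≠ 0 := by have := hy.1; intro h; linarith
    have d1 : HasDerivAt (fun y ↦ (y + h) ^ p) (p * (y + h) ^ (p - 1)) y := by
      simpa using (Real.hasDerivAt_rpow_const (p := p) (Or.inl h2)).comp_add_const y h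
    exact (d1.sub (Real.hasDerivAt_rpow_const (Or.inl h1))).hasDerivWithinAt
  · obtain ⟨hy1, hy2⟩ := hy
    have := abs_rpow_sub_rpow_le (q := p - 1) (n := 2) (m := m) (y := y) (z := y + h) hm
      (by linarith) (by linarith) (by linarith) (by linarith) (by linarith) (by linarith)
    rw [add_sub_cancel_left, abs_of_nonneg hh] at this
    rw [Real.norm_eq_abs, ← mul_sub, abs_mul, abs_of_pos hp]
    have e : p - 1 - 1 = p - 2 := by ring
    rw [e] at this
    have hpp : p * |p - 1| ≤ 2 := by
      have : |p - 1| ≤ 1 := abs_le.2 ⟨by linarith, by linarith⟩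
      nlinarith [abs_nonneg (p - 1)]
    have hmp : 0 ≤ m ^ (p - 2) * h := by positivity
    norm_num at this
    calc p * |(y + h) ^ (p - 1) - y ^ (p - 1)| ≤ p * (|p - 1| * 4 * m ^ (p - 2) * h) := by gcongr
      _ = (p * |p - 1|) * (4 * (m ^ (p - 2) * h)) := by ring
      _ ≤ 2 * (4 * (m ^ (p - 2) * h)) := by gcongr
      _ = _ := by ring

/-- The covariance of the symmetric difference quotients at times `t` and `s`. -/
def quotCov (p ε t s : ℝ) : ℝ :=
  incrCov p (max (t - ε) 0) (t + ε) (max (s - ε) 0) (s + ε) / (4 * ε ^ 2)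

/-- The covariance of the symmetric difference quotient at `t` with the increment over
`[s, t]`. -/
def quotIncrCov (p ε t s : ℝ) : ℝ :=
  incrCov p (max (t - ε) 0) (t + ε) s t / (2 * ε)

theorem quotCov_comm (p ε t s : ℝ) : quotCov p ε t s = quotCov p ε s t := by
  unfold quotCov
  rw [incrCov_comm]

/-- The Cauchy-Schwarz inequality for the covariances of increments. -/
def IncrCovBound (p : ℝ) : Prop :=
  ∀ a b c d : ℝ, 0 ≤ a → 0 ≤ b → 0 ≤ c → 0 ≤ d →
    |incrCov p a b c d| ≤ |b - a| ^ (p / 2) * |d - c| ^ (p / 2)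

theorem quot_window {ε t : ℝ} (hε : 0 < ε) (ht : 0 ≤ t) :
    0 ≤ t + ε - max (t - ε) 0 ∧ t + ε - max (t - ε) 0 ≤ 2 * ε := by
  constructor
  · have : max (t - ε) 0 ≤ t + ε := max_le (by linarith) (by linarith)
    linarith
  · have := le_max_left (t - ε) 0
    linarith

theorem IncrCovBound.abs_quotCov_le_rpow {p ε t s : ℝ} (hCS : IncrCovBound p) (hp : 0 < p)
    (hε : 0 < ε) (ht : 0 ≤ t) (hs : 0 ≤ s) : |quotCov p ε t s| ≤ (2 * ε) ^ (p - 2) := by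
  obtain ⟨t1, t2⟩ := quot_window hε ht
  obtain ⟨s1, s2⟩ := quot_window hε hs
  have h := hCS (max (t - ε) 0) (t + ε) (max (s - ε) 0) (s + ε) (le_max_right _ _)
    (by linarith) (le_max_right _ _) (by linarith)
  rw [abs_of_nonneg t1, abs_of_nonneg s1] at h
  have h2 : |incrCov p (max (t - ε) 0) (t + ε) (max (s - ε) 0) (s + ε)| ≤ (2 * ε) ^ p := by
    refine h.trans ?_
    calc _ ≤ (2 * ε) ^ (p / 2) * (2 * ε) ^ (p / 2) := by gcongr
      _ = _ := by rw [← Real.rpow_add (by positivity)]; ring_nf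
  unfold quotCov
  rw [abs_div, abs_of_pos (by positivity : (0 : ℝ) < 4 * ε ^ 2), div_le_iff₀ (by positivity)]
  refine h2.trans (le_of_eq ?_)
  rw [Real.rpow_sub (by positivity)]
  norm_num
  field_simp
  norm_num

/-- If the windows are close relative to their length, Cauchy-Schwarz suffices; if they are far
apart, γ is a second difference of y ↦ y^p at scale u. -/
theorem IncrCovBound.abs_quotCov_le {p ε t s : ℝ} (hCS : IncrCovBound p) (hp : 0 < p)
    (hp2 : p ≤ 2) (hε : 0 < ε) (ht : 0 ≤ t) (hs : 0 ≤ s) (hts : t ≠ s) :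
    |quotCov p ε t s| ≤ 4 * |t - s| ^ (p - 2) := by
  wlog hlt : t < s generalizing t s
  · rw [quotCov_comm, abs_sub_comm t s]
    exact this hs ht hts.symm (lt_of_le_of_ne (not_lt.1 hlt) hts.symm)
  set u := s - t with hu
  have hu0 : 0 < u := by linarith
  have : |t - s| = u := by rw [abs_sub_comm, abs_of_pos hu0]
  rw [this]
  -- Beyond 4ε all distances between window endpoints lie in [u/2, 2u].
  rcases le_or_gt u (4 * ε) with h | h
  · calc |quotCov p ε t s| ≤ (2 * ε) ^ (p - 2) := hCS.abs_quotCov_le_rpow hp hε ht hs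
      _ ≤ 2 ^ (2 : ℝ) * u ^ (p - 2) := by
        refine (Real.rpow_le_rpow_of_nonpos (by positivity) (?_ : u / 2 ≤ 2 * ε)
          (by linarith)).trans (rpow_le_of_half_le hu0 le_rfl (by linarith) (by linarith)
          (by linarith))
        linarith
      _ = _ := by norm_num
  · obtain ⟨t1, t2⟩ := quot_window hε ht
    have hsm : max (s - ε) 0 = s - ε := max_eq_left (by linarith)
    have ht0 := le_max_right (t - ε) 0
    unfold quotCov
    rw [hsm]
    set a := max (t - ε) 0
    have key := abs_rpow_second_difference_le (p := p) (m := u) (x := s - ε - (t + ε))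
      (h := t + ε - a) (k := 2 * ε) hp hp2 hu0 t1 (by positivity) (by linarith) (by linarith)
    have e1 : |t + ε - (s - ε)| = s - ε - (t + ε) := by
      rw [abs_sub_comm, abs_of_nonneg (by linarith)]
    have e2 : |a - (s + ε)| = s - ε - (t + ε) + 2 * ε + (t + ε - a) := by
      rw [abs_sub_comm, abs_of_nonneg (by linarith)]; ring
    have e3 : |t + ε - (s + ε)| = s - ε - (t + ε) + 2 * ε := by
      rw [abs_sub_comm, abs_of_nonneg (by linarith)]; ring
    have e4 : |a - (s - ε)| = s - ε - (t + ε) + (t + ε - a) := by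
      rw [abs_sub_comm, abs_of_nonneg (by linarith)]; ring
    unfold incrCov
    rw [e1, e2, e3, e4, abs_div, abs_div, abs_of_pos (by positivity : (0 : ℝ) < 4 * ε ^ 2),
      div_le_iff₀ (by positivity), abs_of_pos (by norm_num : (0 : ℝ) < 2),
      div_le_iff₀ (by norm_num)]
    have hup : 0 < u ^ (p - 2) := Real.rpow_pos_of_pos hu0 _
    calc _ = _ := by congr 1; ring
      _ ≤ _ := key
      _ ≤ 8 * (2 * ε) * (2 * ε) * u ^ (p - 2) := by gcongr
      _ = _ := by ring

/-- For t ≥ ε the window is symmetric about t and the terms |a - t|^p and ε^p cancel. For t < ε it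
is cut off at 0; the uncancelled part is at most ε · ε^(p-1), which costs t^(p-1) if p < 1 and is
absorbed in u^(p-1) otherwise. -/
theorem IncrCovBound.abs_quotIncrCov_le {p ε t s : ℝ} (hCS : IncrCovBound p) (hp : 0 < p)
    (hp2 : p ≤ 2) (hε : 0 < ε) (ht : 0 < t) (hs : 0 ≤ s) (hts : t ≠ s) :
    |quotIncrCov p ε t s| ≤ 3 * |t - s| ^ (p - 1) + if p < 1 then t ^ (p - 1) else 0 := by
  set u := |t - s| with hu
  have hu0 : 0 < u := abs_pos.2 (sub_ne_zero.2 hts)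
  have hup : 0 < u ^ (p - 1) := Real.rpow_pos_of_pos hu0 _
  have htp : 0 < t ^ (p - 1) := Real.rpow_pos_of_pos ht _
  obtain ⟨t1, t2⟩ := quot_window hε ht.le
  have ht0 := le_max_right (t - ε) 0
  have hmin : |max (t - ε) 0 - t| = min ε t := by
    rcases le_total ε t with h | h
    · rw [max_eq_left (by linarith), min_eq_left h, abs_sub_comm, abs_of_nonneg (by linarith)]
      ring
    · rw [max_eq_right (by linarith), min_eq_right h, abs_sub_comm, abs_of_nonneg (by linarith)]
      ring
  unfold quotIncrCov
  set a := max (t - ε) 0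
  rw [abs_div, abs_of_pos (by positivity : (0 : ℝ) < 2 * ε), div_le_iff₀ (by positivity)]
  have hif : 0 ≤ if p < 1 then t ^ (p - 1) else 0 := by split_ifs <;> linarith
  rcases le_or_gt u (4 * ε) with h | h
  · have h1 := hCS a (t + ε) s t ht0 (by linarith) hs ht.le
    rw [abs_of_nonneg t1, ← hu] at h1
    have h2 : (2 * ε) ^ (p / 2 - 1) ≤ 2 * u ^ (p / 2 - 1) := by
      refine (Real.rpow_le_rpow_of_nonpos (by positivity) (?_ : u / 2 ≤ 2 * ε)
          (by linarith)).trans ?_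
      · linarith
      · have := rpow_le_of_half_le (q := p / 2 - 1) (n := 1) hu0 le_rfl
          (by linarith) (by linarith) (by linarith)
        simpa using this
    calc |incrCov p a (t + ε) s t| ≤ (2 * ε) ^ (p / 2) * u ^ (p / 2) := by
          refine h1.trans ?_
          gcongr
      _ = (2 * ε) ^ (p / 2 - 1) * u ^ (p / 2) * (2 * ε) := by
          rw [Real.rpow_sub_one (by positivity)]
          field_simp
      _ ≤ 2 * u ^ (p / 2 - 1) * u ^ (p / 2) * (2 * ε) := by gcongr
      _ = 2 * u ^ (p - 1) * (2 * ε) := by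
          rw [mul_assoc 2, ← Real.rpow_add hu0]
          ring_nf
      _ ≤ _ := by gcongr; linarith
  · have hb : |t + ε - t| = ε := by rw [add_sub_cancel_left, abs_of_pos hε]
    have hta : |t - a| ≤ ε := by rw [abs_sub_comm, hmin]; exact min_le_left _ _
    have b1 : u - ε ≤ |t + ε - s| ∧ |t + ε - s| ≤ u + ε := by
      have := abs_abs_sub_abs_le (t + ε - s) (t - s)
      have e : t + ε - s - (t - s) = ε := by ring
      rw [e, abs_of_pos hε, ← hu] at this
      obtain ⟨i, j⟩ := abs_le.1 this
      constructor <;> linarith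
    have b2 : u - ε ≤ |a - s| ∧ |a - s| ≤ u + ε := by
      have := abs_abs_sub_abs_le (a - s) (t - s)
      have e : a - s - (t - s) = -(t - a) := by ring
      rw [e, abs_neg, ← hu] at this
      obtain ⟨i, j⟩ := abs_le.1 (this.trans hta)
      constructor <;> linarith
    have hd : |(|t + ε - s| - |a - s|)| ≤ 2 * ε := by
      refine (abs_abs_sub_abs_le _ _).trans ?_
      have e : t + ε - s - (a - s) = t + ε - a := by ring
      rw [e, abs_of_nonneg t1]
      exact t2
    have m1 := abs_rpow_sub_rpow_le (q := p) (n := 1) (m := u) (y := |a - s|)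
      (z := |t + ε - s|) hu0 (by linarith) (by linarith) (by linarith) (by linarith) (by linarith)
      (by linarith)
    have m2 : |(|t + ε - s|) ^ p - |a - s| ^ p| ≤ 8 * ε * u ^ (p - 1) := by
      refine m1.trans ?_
      rw [abs_of_pos hp, Real.rpow_one]
      calc p * 2 * u ^ (p - 1) * |(|t + ε - s| - |a - s|)| ≤ 2 * 2 * u ^ (p - 1) * (2 * ε) := by
            gcongr
        _ = _ := by ring
    have m3 : |(min ε t) ^ p - ε ^ p| ≤
        ε * (4 * u ^ (p - 1) + if p < 1 then t ^ (p - 1) else 0) := by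
      rcases le_total ε t with h' | h'
      · rw [min_eq_left h', sub_self, abs_zero]
        positivity
      · rw [min_eq_right h', abs_sub_comm, abs_of_nonneg
          (sub_nonneg.2 (Real.rpow_le_rpow ht.le h' hp.le))]
        have e1 : ε ^ p = ε * ε ^ (p - 1) := by rw [Real.rpow_sub_one hε.ne']; field_simp
        have e2 : 0 ≤ t ^ p := by positivity
        have e3 : ε ^ (p - 1) ≤ 4 * u ^ (p - 1) + if p < 1 then t ^ (p - 1) else 0 := by
          split_ifs with hp1
          · have := Real.rpow_le_rpow_of_nonpos ht h' (by linarith : p - 1 ≤ 0)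
            linarith
          · have := Real.rpow_le_rpow hε.le (by linarith : ε ≤ u) (by linarith : 0 ≤ p - 1)
            linarith
        have := mul_le_mul_of_nonneg_left e3 hε.le
        linarith
    unfold incrCov
    rw [hmin, hb, abs_div, abs_of_pos (by norm_num : (0 : ℝ) < 2), div_le_iff₀ (by norm_num)]
    set I : ℝ := if p < 1 then t ^ (p - 1) else 0
    calc |(|t + ε - s|) ^ p + min ε t ^ p - ε ^ p - |a - s| ^ p|
        = |((|t + ε - s|) ^ p - |a - s| ^ p) + (min ε t ^ p - ε ^ p)| := by congr 1; ring
      _ ≤ 8 * ε * u ^ (p - 1) + ε * (4 * u ^ (p - 1) + I) :=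
          (abs_add_le _ _).trans (add_le_add m2 m3)
      _ ≤ _ := by nlinarith [mul_nonneg hε.le hif]

/-! ### Integrable power singularities on the square -/

theorem intervalIntegrable_abs_rpow {q : ℝ} (hq : -1 < q) (T : ℝ) :
    IntervalIntegrable (fun x : ℝ ↦ |x| ^ q) volume (-T) T := by
  have key : ∀ c : ℝ, 0 ≤ c → IntervalIntegrable (fun x : ℝ ↦ |x| ^ q) volume 0 c := by
    intro c hc
    refine (intervalIntegral.intervalIntegrable_rpow' hq (a := 0) (b := c)).congr fun x hx ↦ ?_
    rw [uIoc_of_le hc] at hx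
    simp only [abs_of_pos hx.1]
  have key2 : ∀ c : ℝ, IntervalIntegrable (fun x : ℝ ↦ |x| ^ q) volume 0 c := by
    intro c
    rcases le_total 0 c with hc | hc
    · exact key c hc
    · rw [IntervalIntegrable.iff_comp_neg]
      simpa using key (-c) (by linarith)
  exact (key2 _).symm.trans (key2 _)

theorem integrableOn_rpow_Icc {q : ℝ} (hq : -1 < q) {T : ℝ} (hT : 0 < T) :
    IntegrableOn (fun x : ℝ ↦ x ^ q) (Icc 0 T) :=
  (intervalIntegrable_iff_integrableOn_Icc_of_le hT.le).1
    (intervalIntegral.intervalIntegrable_rpow' hq)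

/-- This is the integrand of the convolution of two integrable truncated powers. -/
theorem integrableOn_rpow_snd_mul_abs_sub_rpow {q r : ℝ} (hq : -1 < q) (hr : -1 < r) {T : ℝ}
    (hT : 0 < T) :
    IntegrableOn (fun z : ℝ × ℝ ↦ z.2 ^ q * |z.1 - z.2| ^ r) (Icc 0 T ×ˢ Icc 0 T) := by
  have h1 : Integrable ((Icc 0 T).indicator fun x : ℝ ↦ x ^ q) :=
    (integrableOn_rpow_Icc hq hT).integrable_indicator measurableSet_Icc
  have h2 : Integrable ((Icc (-T) T).indicator fun x : ℝ ↦ |x| ^ r) :=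
    ((intervalIntegrable_iff_integrableOn_Icc_of_le (by linarith)).1
      (intervalIntegrable_abs_rpow hr T)).integrable_indicator measurableSet_Icc
  have h := (h1.convolution_integrand (ContinuousLinearMap.mul ℝ ℝ) h2).integrableOn
    (s := Icc 0 T ×ˢ Icc 0 T)
  refine h.congr_fun (fun z hz ↦ ?_) (measurableSet_Icc.prod measurableSet_Icc)
  obtain ⟨⟨a1, a2⟩, b1, b2⟩ := hz
  have m2 : z.1 - z.2 ∈ Icc (-T) T := ⟨by linarith, by linarith⟩
  simp only [ContinuousLinearMap.mul_apply']
  rw [indicator_of_mem (show z.2 ∈ Icc 0 T from ⟨b1, b2⟩), indicator_of_mem m2]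

theorem integrableOn_rpow_fst_mul_abs_sub_rpow {q r : ℝ} (hq : -1 < q) (hr : -1 < r) {T : ℝ}
    (hT : 0 < T) :
    IntegrableOn (fun z : ℝ × ℝ ↦ z.1 ^ q * |z.1 - z.2| ^ r) (Icc 0 T ×ˢ Icc 0 T) := by
  have h := integrableOn_rpow_snd_mul_abs_sub_rpow hq hr hT
  rw [Measure.volume_eq_prod] at h ⊢
  refine h.swap.congr_fun (fun z _ ↦ ?_) (measurableSet_Icc.prod measurableSet_Icc)
  simp [abs_sub_comm z.1 z.2]

theorem integrableOn_abs_sub_rpow {r : ℝ} (hr : -1 < r) {T : ℝ} (hT : 0 < T) :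
    IntegrableOn (fun z : ℝ × ℝ ↦ |z.1 - z.2| ^ r) (Icc 0 T ×ˢ Icc 0 T) := by
  simpa using integrableOn_rpow_snd_mul_abs_sub_rpow (q := 0) (by norm_num) hr hT

/-! ### The telescoping double integral of the quotient covariance -/

/-- The covariance function of fractional Brownian motion with Hurst index `p / 2`, extended by
`0` to negative times. -/
def fbmCov (p x y : ℝ) : ℝ :=
  ((max x 0) ^ p + (max y 0) ^ p - |max x 0 - max y 0| ^ p) / 2

theorem continuous_fbmCov {p : ℝ} (hp : 0 < p) : Continuous fun z : ℝ × ℝ ↦ fbmCov p z.1 z.2 := by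
  unfold fbmCov
  have h : Continuous fun x : ℝ ↦ x ^ p := Real.continuous_rpow_const hp.le
  exact (((h.comp (by fun_prop : Continuous fun z : ℝ × ℝ ↦ max z.1 0)).add
    (h.comp (by fun_prop : Continuous fun z : ℝ × ℝ ↦ max z.2 0))).sub
    (h.comp (by fun_prop : Continuous fun z : ℝ × ℝ ↦ |max z.1 0 - max z.2 0|))).div_const 2

theorem abs_fbmCov_le {p x y M : ℝ} (hp : 0 < p) (hM : 0 ≤ M) (hx : x ≤ M) (hy : y ≤ M) :
    |fbmCov p x y| ≤ 2 * M ^ p := by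
  have hx0 := le_max_right x 0
  have hy0 := le_max_right y 0
  have hxM : max x 0 ≤ M := max_le hx hM
  have hyM : max y 0 ≤ M := max_le hy hM
  have h3 : |max x 0 - max y 0| ≤ M := abs_le.2 ⟨by linarith, by linarith⟩
  have e1 := Real.rpow_le_rpow hx0 hxM hp.le
  have e2 := Real.rpow_le_rpow hy0 hyM hp.le
  have e3 := Real.rpow_le_rpow (abs_nonneg _) h3 hp.le
  have f1 := Real.rpow_nonneg hx0 p
  have f2 := Real.rpow_nonneg hy0 p
  have f3 := Real.rpow_nonneg (abs_nonneg (max x 0 - max y 0)) p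
  unfold fbmCov
  exact abs_le.2 ⟨by linarith, by linarith⟩

theorem quotCov_eq_fbmCov {p ε t s : ℝ} (hε : 0 < ε) (ht : 0 ≤ t) (hs : 0 ≤ s) :
    quotCov p ε t s = (4 * ε ^ 2)⁻¹ * ((fbmCov p (t + ε) (s + ε) - fbmCov p (t + ε) (s - ε)) -
      (fbmCov p (t - ε) (s + ε) - fbmCov p (t - ε) (s - ε))) := by
  unfold quotCov incrCov fbmCov
  rw [max_eq_left (by linarith : (0 : ℝ) ≤ t + ε), max_eq_left (by linarith : (0 : ℝ) ≤ s + ε)]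
  ring

/-- The two shifted integrals cancel except on the windows [T - ε, T + ε] and [-ε, ε], each of
length 2ε. -/
theorem abs_integral_shift_sub_shift_le {g : ℝ → ℝ} (hg : Continuous g) {T ε M : ℝ}
    (hT : 0 < T) (hε : 0 < ε) (hM : ∀ x ≤ T + ε, |g x| ≤ M) :
    |∫ t in (0 : ℝ)..T, (g (t + ε) - g (t - ε))| ≤ 4 * ε * M := by
  have h1 : Continuous fun t ↦ g (t + ε) := by fun_prop
  have h2 : Continuous fun t ↦ g (t - ε) := by fun_prop
  rw [intervalIntegral.integral_sub (h1.intervalIntegrable _ _) (h2.intervalIntegrable _ _),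
    intervalIntegral.integral_comp_add_right, intervalIntegral.integral_comp_sub_right,
    intervalIntegral.integral_interval_sub_interval_comm' (hg.intervalIntegrable _ _)
      (hg.intervalIntegrable _ _) (hg.intervalIntegrable _ _)]
  have b1 := intervalIntegral.norm_integral_le_of_norm_le_const (a := T - ε) (b := T + ε)
    (f := g) (C := M) fun x hx ↦ by
      rw [uIoc_of_le (by linarith)] at hx
      exact hM x hx.2
  have b2 := intervalIntegral.norm_integral_le_of_norm_le_const (a := 0 - ε) (b := 0 + ε)
    (f := g) (C := M) fun x hx ↦ by
      rw [uIoc_of_le (by linarith)] at hx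
      exact hM x (by linarith [hx.2])
  have e1 : |T + ε - (T - ε)| = 2 * ε := by
    rw [abs_of_pos (by linarith)]; ring
  have e2 : |0 + ε - (0 - ε)| = 2 * ε := by
    rw [abs_of_pos (by linarith)]; ring
  rw [e1] at b1
  rw [e2] at b2
  rw [← Real.norm_eq_abs]
  exact (norm_sub_le _ _).trans (by linarith)

theorem integrableOn_quotCov {p ε T : ℝ} (hp : 0 < p) (hε : 0 < ε) :
    IntegrableOn (fun z : ℝ × ℝ ↦ quotCov p ε z.1 z.2) (Icc 0 T ×ˢ Icc 0 T) := by
  have hc := continuous_fbmCov hp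
  have h : Continuous fun z : ℝ × ℝ ↦ (4 * ε ^ 2)⁻¹ *
      ((fbmCov p (z.1 + ε) (z.2 + ε) - fbmCov p (z.1 + ε) (z.2 - ε)) -
        (fbmCov p (z.1 - ε) (z.2 + ε) - fbmCov p (z.1 - ε) (z.2 - ε))) := by
    refine continuous_const.mul (((?_ : Continuous _).sub ?_).sub ((?_ : Continuous _).sub ?_))
    · exact hc.comp (by fun_prop : Continuous fun z : ℝ × ℝ ↦ (z.1 + ε, z.2 + ε))
    · exact hc.comp (by fun_prop : Continuous fun z : ℝ × ℝ ↦ (z.1 + ε, z.2 - ε))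
    · exact hc.comp (by fun_prop : Continuous fun z : ℝ × ℝ ↦ (z.1 - ε, z.2 + ε))
    · exact hc.comp (by fun_prop : Continuous fun z : ℝ × ℝ ↦ (z.1 - ε, z.2 - ε))
  refine (h.continuousOn.integrableOn_compact (isCompact_Icc.prod isCompact_Icc)).congr_fun
    (fun z hz ↦ ?_) (measurableSet_Icc.prod measurableSet_Icc)
  exact (quotCov_eq_fbmCov hε hz.1.1 hz.2.1).symm

/-- Telescoping in each variable yields a factor 4ε, and (4ε)² compensates the denominator 4ε². This
replaces the bound u^(p-2), whose integral diverges for p ≤ 1. -/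
theorem IncrCovBound.abs_integral_quotCov_le {p ε T : ℝ} (hCS : IncrCovBound p) (hp : 0 < p)
    (hp2 : p ≤ 2) (hε : 0 < ε) (hT : 0 < T) :
    |∫ z in Icc (0 : ℝ) T ×ˢ Icc (0 : ℝ) T, quotCov p ε z.1 z.2| ≤
      (2 * T) ^ (p - 2) * T ^ 2 + 8 * (2 * T) ^ p := by
  have hc := continuous_fbmCov hp
  have hpos1 : 0 ≤ (2 * T) ^ (p - 2) * T ^ 2 := by positivity
  have hpos2 : 0 ≤ 8 * (2 * T) ^ p := by positivity
  -- For large ε the crude bound (2ε)^(p-2) is enough; for ε ≤ T all times are at most 2T, so the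
  -- covariance function is at most 2 (2T)^p.
  rcases le_total T ε with h | h
  · have hb := norm_setIntegral_le_of_norm_le_const (μ := volume)
      (s := Icc (0 : ℝ) T ×ˢ Icc (0 : ℝ) T)
      (f := fun z : ℝ × ℝ ↦ quotCov p ε z.1 z.2) (C := (2 * T) ^ (p - 2))
      ((isCompact_Icc.prod isCompact_Icc).measure_lt_top) (fun z hz ↦ by
        refine (hCS.abs_quotCov_le_rpow hp hε hz.1.1 hz.2.1).trans ?_
        exact Real.rpow_le_rpow_of_nonpos (by positivity) (by linarith) (by linarith))
    have hvol : volume.real (Icc (0 : ℝ) T ×ˢ Icc (0 : ℝ) T) = T ^ 2 := by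
      rw [Measure.volume_eq_prod, measureReal_prod_prod]
      simp [hT.le, sq]
    rw [hvol, Real.norm_eq_abs] at hb
    linarith
  · set h : ℝ → ℝ := fun x ↦ ∫ s in (0 : ℝ)..T, (fbmCov p x (s + ε) - fbmCov p x (s - ε)) with hh
    have hhc : Continuous h := by
      refine intervalIntegral.continuous_parametric_intervalIntegral_of_continuous
        (f := fun x s ↦ fbmCov p x (s + ε) - fbmCov p x (s - ε)) ?_ continuous_const
      exact (hc.comp (by fun_prop : Continuous fun z : ℝ × ℝ ↦ (z.1, z.2 + ε))).sub
        (hc.comp (by fun_prop : Continuous fun z : ℝ × ℝ ↦ (z.1, z.2 - ε)))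
    have hhM : ∀ x ≤ T + ε, |h x| ≤ 4 * ε * (2 * (2 * T) ^ p) := by
      intro x hx
      refine abs_integral_shift_sub_shift_le (g := fun y ↦ fbmCov p x y) ?_ hT hε ?_
      · exact hc.comp (by fun_prop : Continuous fun y : ℝ ↦ (x, y))
      · exact fun y hy ↦ abs_fbmCov_le hp (by linarith) (by linarith) (by linarith)
    have hfin := abs_integral_shift_sub_shift_le hhc hT hε hhM
    have heq : ∫ z in Icc (0 : ℝ) T ×ˢ Icc (0 : ℝ) T, quotCov p ε z.1 z.2 =
        (4 * ε ^ 2)⁻¹ * ∫ t in (0 : ℝ)..T, (h (t + ε) - h (t - ε)) := by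
      have hi := integrableOn_quotCov (T := T) hp hε
      rw [Measure.volume_eq_prod] at hi ⊢
      rw [setIntegral_prod _ hi, intervalIntegral.integral_of_le hT.le,
        ← integral_Icc_eq_integral_Ioc, ← integral_const_mul]
      refine setIntegral_congr_fun measurableSet_Icc fun t ht ↦ ?_
      have j : ∀ x : ℝ, IntervalIntegrable
          (fun s ↦ fbmCov p x (s + ε) - fbmCov p x (s - ε)) volume 0 T := fun x ↦
        Continuous.intervalIntegrable
          ((hc.comp (by fun_prop : Continuous fun s : ℝ ↦ (x, s + ε))).sub
            (hc.comp (by fun_prop : Continuous fun s : ℝ ↦ (x, s - ε)))) _ _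
      simp only [hh]
      rw [← intervalIntegral.integral_sub (j _) (j _), intervalIntegral.integral_of_le hT.le,
        ← integral_Icc_eq_integral_Ioc, ← integral_const_mul]
      refine setIntegral_congr_fun measurableSet_Icc fun s hs ↦ ?_
      exact quotCov_eq_fbmCov hε ht.1 hs.1
    rw [heq, abs_mul, abs_of_pos (by positivity : (0 : ℝ) < (4 * ε ^ 2)⁻¹)]
    have : (4 * ε ^ 2)⁻¹ * (4 * ε * (4 * ε * (2 * (2 * T) ^ p))) = 8 * (2 * T) ^ p := by
      field_simp
      norm_num
    calc _ ≤ (4 * ε ^ 2)⁻¹ * (4 * ε * (4 * ε * (2 * (2 * T) ^ p))) := by gcongr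
      _ ≤ _ := by rw [this]; linarith

/-! ### Comparison of (1 + x)^(-d/2) with powers of x -/

theorem one_sub_one_add_rpow_neg_le {m x θ : ℝ} (hm : 0 ≤ m) (hx : 0 < x) (h0 : 0 ≤ θ)
    (h1 : θ ≤ 1) : |(1 + x) ^ (-m) - 1| ≤ (1 + m) * x ^ θ := by
  have hpos : 0 < 1 + x := by linarith
  have hle : (1 + x) ^ (-m) ≤ 1 :=
    Real.rpow_le_one_of_one_le_of_nonpos (by linarith) (by linarith)
  have hnn : 0 < (1 + x) ^ (-m) := Real.rpow_pos_of_pos hpos _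
  rw [abs_sub_comm, abs_of_nonneg (by linarith)]
  have hxθ : 0 < x ^ θ := Real.rpow_pos_of_pos hx _
  rcases le_total x 1 with h | h
  · have e1 : 1 - m * x ≤ (1 + x) ^ (-m) := by
      rw [Real.rpow_def_of_pos hpos]
      have l1 := Real.log_le_sub_one_of_pos hpos
      have l2 := Real.add_one_le_exp (Real.log (1 + x) * -m)
      nlinarith
    have e2 : x ≤ x ^ θ := by
      simpa using Real.rpow_le_rpow_of_exponent_ge hx h h1
    nlinarith
  · have : 1 ≤ x ^ θ := Real.one_le_rpow h h0
    nlinarith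

theorem one_add_rpow_neg_mul_div_le {m x θ : ℝ} (hm : 0 ≤ m) (hx : 0 < x) (h0 : 0 ≤ θ)
    (h1 : θ ≤ 1) : (1 + x) ^ (-m) * (x / (1 + x)) ≤ x ^ θ := by
  have hpos : 0 < 1 + x := by linarith
  have hle : (1 + x) ^ (-m) ≤ 1 :=
    Real.rpow_le_one_of_one_le_of_nonpos (by linarith) (by linarith)
  have hd : 0 ≤ x / (1 + x) := by positivity
  have h2 : x / (1 + x) ≤ x ^ θ := by
    rcases le_total x 1 with h | h
    · have : x ≤ x ^ θ := by simpa using Real.rpow_le_rpow_of_exponent_ge hx h h1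
      refine le_trans ?_ this
      exact div_le_self hx.le (by linarith)
    · have : 1 ≤ x ^ θ := Real.one_le_rpow h h0
      refine le_trans ?_ this
      rw [div_le_one hpos]
      linarith
  calc _ ≤ 1 * (x / (1 + x)) := by gcongr
    _ ≤ _ := by linarith

theorem one_add_rpow_neg_le {m x θ : ℝ} (hx : 0 < x) (h0 : θ ≤ 0) (h1 : -m ≤ θ) :
    (1 + x) ^ (-m) ≤ x ^ θ := by
  have hpos : 0 < 1 + x := by linarith
  calc (1 + x) ^ (-m) ≤ (1 + x) ^ θ := Real.rpow_le_rpow_of_exponent_le (by linarith) h1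
    _ ≤ x ^ θ := Real.rpow_le_rpow_of_nonpos hx (by linarith) h0

/-- The choice of the exponent `θ` with which `(1 + x) ^ (-d/2)` is compared, after subtraction
of its value at `0` when `p ≤ 1`. -/
theorem exists_comparison_exponent {d : ℕ} (hd : 1 ≤ d) {p α : ℝ} (hp1 : 1 / 2 < p) (hp2 : p < 2)
    (hα : (d : ℝ) / 2 - 1 + 1 / p < α) :
    ∃ θ c C : ℝ, 0 ≤ C ∧ (c = 0 ∨ c = 1 ∧ 0 < α - (d : ℝ) / 2) ∧ θ < α - (d : ℝ) / 2 ∧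
      1 - p < p * θ ∧ ∀ x : ℝ, 0 < x → |(1 + x) ^ (-((d : ℝ) / 2)) - c| ≤ C * x ^ θ ∧
        (1 + x) ^ (-((d : ℝ) / 2)) * (x / (1 + x)) ≤ C * x ^ θ := by
  have hp : 0 < p := by linarith
  have hd' : (1 : ℝ) ≤ d := by exact_mod_cast hd
  rcases le_or_gt p 1 with h | h
  -- Here c = 1. The room below 1 comes from p > 1/2; moreover α - d/2 > θ ≥ 0, so the weight itself
  -- is integrable.
  · have h1 : 1 / p - 1 < min 1 (α - (d : ℝ) / 2) := by
      refine lt_min ?_ (by linarith)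
      have : 1 / p < 2 := by rw [div_lt_iff₀ hp]; linarith
      linarith
    obtain ⟨θ, hθ1, hθ2⟩ := exists_between h1
    have hθ0 : 0 ≤ θ := by
      have : 1 ≤ 1 / p := by rw [le_div_iff₀ hp]; linarith
      linarith
    have hθ3 := hθ2.trans_le (min_le_left _ _)
    have hθ4 := hθ2.trans_le (min_le_right _ _)
    refine ⟨θ, 1, 1 + (d : ℝ) / 2, by positivity, Or.inr ⟨rfl, by linarith⟩, hθ4, ?_,
      fun x hx ↦ ⟨?_, ?_⟩⟩
    · have : (1 / p - 1) * p < θ * p := by gcongr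
      have e : (1 / p - 1) * p = 1 - p := by field_simp
      linarith
    · exact one_sub_one_add_rpow_neg_le (by positivity) hx hθ0 hθ3.le
    · refine (one_add_rpow_neg_mul_div_le (by positivity) hx hθ0 hθ3.le).trans ?_
      have : 0 < x ^ θ := Real.rpow_pos_of_pos hx _
      nlinarith
  -- Here c = 0 and θ < 0. Decay of order x^θ requires -d/2 ≤ θ, which follows from d ≥ 1 and 1/p -
  -- 1 > -1/2.
  · have hp1' : 1 / 2 < 1 / p := one_div_lt_one_div_of_lt hp hp2
    have h1 : 1 / p - 1 < min 0 (α - (d : ℝ) / 2) := by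
      refine lt_min ?_ (by linarith)
      have : 1 / p < 1 := by rw [div_lt_iff₀ hp]; linarith
      linarith
    obtain ⟨θ, hθ1, hθ2⟩ := exists_between h1
    have hθ3 := hθ2.trans_le (min_le_left _ _)
    have hθ4 := hθ2.trans_le (min_le_right _ _)
    have key : ∀ x : ℝ, 0 < x → (1 + x) ^ (-((d : ℝ) / 2)) ≤ x ^ θ := fun x hx ↦
      one_add_rpow_neg_le hx hθ3.le (by linarith)
    refine ⟨θ, 0, 1, zero_le_one, Or.inl rfl, hθ4, ?_, fun x hx ↦ ⟨?_, ?_⟩⟩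
    · have : (1 / p - 1) * p < θ * p := by gcongr
      have e : (1 / p - 1) * p = 1 - p := by field_simp
      linarith
    · rw [sub_zero, abs_of_pos (by positivity), one_mul]
      exact key x hx
    · rw [one_mul]
      refine le_trans ?_ (key x hx)
      refine mul_le_of_le_one_right (by positivity) ?_
      rw [div_le_one (by positivity)]
      linarith

/-! ### The Bessel kernel as a mixture of Gaussians -/

/-- The weight of the heat kernels in the Bessel kernel. -/
def besselWeight (d : ℕ) (α r : ℝ) : ℝ := r ^ (α - (d : ℝ) / 2) * Real.exp (-r) / r

theorem besselWeight_nonneg (d : ℕ) (α : ℝ) {r : ℝ} (hr : 0 < r) : 0 ≤ besselWeight d α r := by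
  unfold besselWeight
  positivity

theorem measurable_besselWeight (d : ℕ) (α : ℝ) : Measurable (besselWeight d α) := by
  unfold besselWeight
  fun_prop

/-- Up to a constant this is the integrand of Γ(α - d/2 - θ). -/
theorem integrableOn_besselWeight_mul_rpow {d : ℕ} {α θ : ℝ} (h : θ < α - (d : ℝ) / 2) :
    IntegrableOn (fun r ↦ besselWeight d α r * (2 * r) ^ (-θ)) (Ioi 0) := by
  have h1 := (Real.GammaIntegral_convergent (s := α - (d : ℝ) / 2 - θ) (by linarith)).const_mul
    ((2 : ℝ) ^ (-θ))
  refine IntegrableOn.congr_fun h1 (fun r hr ↦ ?_) measurableSet_Ioi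
  have hr' : (0 : ℝ) < r := hr
  simp only [besselWeight]
  rw [Real.mul_rpow (by norm_num) hr'.le, Real.rpow_sub_one hr'.ne',
    sub_eq_add_neg (α - (d : ℝ) / 2), Real.rpow_add hr']
  ring

theorem integrableOn_const_mul_besselWeight {d : ℕ} {α c : ℝ}
    (h : c = 0 ∨ c = 1 ∧ 0 < α - (d : ℝ) / 2) :
    IntegrableOn (fun r ↦ c * besselWeight d α r) (Ioi 0) := by
  rcases h with rfl | ⟨rfl, h⟩
  · simp
  · simpa using integrableOn_besselWeight_mul_rpow h

theorem besselKernel_eq (d : ℕ) (α : ℝ) (x : EuclideanSpace ℝ (Fin d)) :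
    besselKernel d α x = (Real.Gamma α * (4 * Real.pi) ^ ((d : ℝ) / 2))⁻¹ *
      ∫ r in Ioi (0 : ℝ), besselWeight d α r * Real.exp (-(4 * r)⁻¹ * ‖x‖ ^ 2) := by
  unfold besselKernel besselWeight
  congr 1
  refine setIntegral_congr_fun measurableSet_Ioi fun r hr ↦ ?_
  have hr' : (0 : ℝ) < r := hr
  have : -‖x‖ ^ 2 / (4 * r) - r = -r + -(4 * r)⁻¹ * ‖x‖ ^ 2 := by
    field_simp
    ring
  rw [this, Real.exp_add]
  ring

/-! ### One-dimensional fractional Brownian motion -/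

section Scalar

variable {Ω : Type*} [MeasurableSpace Ω] {P : Measure Ω} {H : ℝ} {B : ℝ≥0 → Ω → ℝ}

theorem IsFBM.memLp_two (hB : IsFBM H B P) (t : ℝ≥0) : MemLp (B t) 2 P :=
  (hB.gaussian.hasGaussianLaw_eval t).memLp_two

theorem IsFBM.integral_mul (hB : IsFBM H B P) (s t : ℝ≥0) :
    ∫ ω, B s ω * B t ω ∂P =
      (1 / 2) * ((s : ℝ) ^ (2 * H) + (t : ℝ) ^ (2 * H) - |(s : ℝ) - (t : ℝ)| ^ (2 * H)) := by
  have := hB.gaussian.isProbabilityMeasure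
  rw [← hB.covariance_eq, covariance_eq_sub (hB.memLp_two s) (hB.memLp_two t), hB.mean_zero s]
  simp

theorem IsFBM.integral_incr_mul_incr (hB : IsFBM H B P) (a b c d : ℝ≥0) :
    ∫ ω, (B b ω - B a ω) * (B d ω - B c ω) ∂P = incrCov (2 * H) a b c d := by
  have hi : ∀ s t, Integrable (fun ω ↦ B s ω * B t ω) P := fun s t ↦
    (hB.memLp_two s).integrable_mul (hB.memLp_two t)
  have e : (fun ω ↦ (B b ω - B a ω) * (B d ω - B c ω)) = fun ω ↦
      (B b ω * B d ω - B b ω * B c ω) - (B a ω * B d ω - B a ω * B c ω) := by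
    ext ω; ring
  have hd : ∀ s, Integrable (fun ω ↦ B s ω * B d ω - B s ω * B c ω) P := fun s ↦
    (hi _ _).sub (hi _ _)
  rw [e, integral_sub (hd _) (hd _), integral_sub (hi _ _) (hi _ _),
    integral_sub (hi _ _) (hi _ _)]
  simp only [hB.integral_mul, incrCov]
  ring

theorem incrCov_self {p : ℝ} (hp : p ≠ 0) (a b : ℝ) : incrCov p a b a b = |b - a| ^ p := by
  unfold incrCov
  rw [sub_self, sub_self, abs_zero, Real.zero_rpow hp, abs_sub_comm a b]
  ring

/-- Cauchy-Schwarz in L²(P), read off the discriminant of x ↦ E(V + xU)². The process serves only to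
show that the covariance is positive semidefinite. -/
theorem IsFBM.incrCovBound (hB : IsFBM H B P) (hH : 0 < H) : IncrCovBound (2 * H) := by
  intro a b c d ha hb hc hd
  lift a to ℝ≥0 using ha
  lift b to ℝ≥0 using hb
  lift c to ℝ≥0 using hc
  lift d to ℝ≥0 using hd
  set U : Ω → ℝ := fun ω ↦ B b ω - B a ω
  set V : Ω → ℝ := fun ω ↦ B d ω - B c ω
  have hU : MemLp U 2 P := (hB.memLp_two b).sub (hB.memLp_two a)
  have hV : MemLp V 2 P := (hB.memLp_two d).sub (hB.memLp_two c)
  have hUU : ∫ ω, U ω * U ω ∂P = |(b : ℝ) - a| ^ (2 * H) := by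
    rw [← incrCov_self (by positivity)]
    exact hB.integral_incr_mul_incr a b a b
  have hVV : ∫ ω, V ω * V ω ∂P = |(d : ℝ) - c| ^ (2 * H) := by
    rw [← incrCov_self (by positivity)]
    exact hB.integral_incr_mul_incr c d c d
  have hUV : ∫ ω, U ω * V ω ∂P = incrCov (2 * H) a b c d := hB.integral_incr_mul_incr a b c d
  have hdisc := discrim_le_zero (a := ∫ ω, U ω * U ω ∂P) (b := 2 * ∫ ω, U ω * V ω ∂P)
    (c := ∫ ω, V ω * V ω ∂P) (fun x ↦ by
      have h0 : 0 ≤ ∫ ω, (V ω + x * U ω) ^ 2 ∂P := integral_nonneg fun ω ↦ sq_nonneg _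
      have e : (fun ω ↦ (V ω + x * U ω) ^ 2) = fun ω ↦
          V ω * V ω + (2 * x) * (U ω * V ω) + x ^ 2 * (U ω * U ω) := by
        ext ω; ring
      have iVV : Integrable (fun ω ↦ V ω * V ω) P := hV.integrable_mul hV
      have iUV : Integrable (fun ω ↦ U ω * V ω) P := hU.integrable_mul hV
      have iUU : Integrable (fun ω ↦ U ω * U ω) P := hU.integrable_mul hU
      rw [e, integral_add_const_mul_add_const_mul iVV iUV iUU] at h0
      linarith)
  rw [discrim, hUU, hVV, hUV] at hdisc
  refine abs_le_of_sq_le_sq ?_ (by positivity)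
  have e : 2 * H / 2 + 2 * H / 2 = 2 * H := by ring
  have e1 : (|(b : ℝ) - a| ^ (2 * H / 2)) ^ 2 = |(b : ℝ) - a| ^ (2 * H) := by
    rw [sq, ← Real.rpow_add_of_nonneg (abs_nonneg _) (by positivity) (by positivity), e]
  have e2 : (|(d : ℝ) - c| ^ (2 * H / 2)) ^ 2 = |(d : ℝ) - c| ^ (2 * H) := by
    rw [sq, ← Real.rpow_add_of_nonneg (abs_nonneg _) (by positivity) (by positivity), e]
  rw [mul_pow, e1, e2]
  linarith

theorem IsFBM.hasGaussianLaw_incr (hB : IsFBM H B P) (k : ℝ) (s t a b c d : ℝ≥0) :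
    HasGaussianLaw (fun ω ↦ (B t ω - B s ω, k * (B b ω - B a ω), k * (B d ω - B c ω))) P := by
  classical
  set I : Finset ℝ≥0 := {s, t, a, b, c, d} with hI
  let π (x : ℝ≥0) (hx : x ∈ I) : (I → ℝ) →L[ℝ] ℝ := ContinuousLinearMap.proj ⟨x, hx⟩
  exact (hB.gaussian.hasGaussianLaw I).map_fun
    ((π t (by simp [hI]) - π s (by simp [hI])).prod
      ((k • (π b (by simp [hI]) - π a (by simp [hI]))).prod
        (k • (π d (by simp [hI]) - π c (by simp [hI])))))

theorem IsFBM.integral_incr (hB : IsFBM H B P) (k : ℝ) (a b : ℝ≥0) :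
    ∫ ω, k * (B b ω - B a ω) ∂P = 0 := by
  have hi : ∀ t, Integrable (B t) P := fun t ↦ (hB.gaussian.hasGaussianLaw_eval t).integrable
  rw [integral_const_mul, integral_sub (hi _) (hi _), hB.mean_zero, hB.mean_zero]
  simp

theorem IsFBM.integral_exp_neg_mul_sq (hB : IsFBM H B P) (hH : 0 < H) {s t : ℝ≥0} (hst : s ≠ t)
    {l : ℝ} (hl : 0 ≤ l) :
    ∫ ω, Real.exp (-l * (B t ω - B s ω) ^ 2) ∂P =
      (1 + 2 * l * |(t : ℝ) - s| ^ (2 * H)) ^ (-(1 / 2) : ℝ) := by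
  have hts : 0 < |(t : ℝ) - s| := abs_pos.2 (sub_ne_zero.2 (NNReal.coe_injective.ne hst.symm))
  refine (HasGaussianLaw.integral_exp_neg_mul_sq (hB.hasGaussianLaw_incr 1 s t s t s t).fst
    ?_ (by positivity) ?_ hl).1
  · simpa using hB.integral_incr 1 s t
  · rw [← incrCov_self (by positivity), ← hB.integral_incr_mul_incr]
    simp only [sq]

theorem IsFBM.integral_exp_neg_mul_sq_mul_mul (hB : IsFBM H B P) (hH : 0 < H) {s t : ℝ≥0}
    (hst : s ≠ t) (k : ℝ) (a b c d : ℝ≥0) {l : ℝ} (hl : 0 ≤ l) :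
    ∫ ω, Real.exp (-l * (B t ω - B s ω) ^ 2) *
        ((k * (B b ω - B a ω)) * (k * (B d ω - B c ω))) ∂P =
      (1 + 2 * l * |(t : ℝ) - s| ^ (2 * H)) ^ (-(1 / 2) : ℝ) *
        (k ^ 2 * incrCov (2 * H) a b c d -
          (k * incrCov (2 * H) a b s t) * (k * incrCov (2 * H) c d s t) *
            (2 * l / (1 + 2 * l * |(t : ℝ) - s| ^ (2 * H)))) := by
  have hts : 0 < |(t : ℝ) - s| := abs_pos.2 (sub_ne_zero.2 (NNReal.coe_injective.ne hst.symm))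
  have e1 : ∀ a b c d : ℝ≥0, ∫ ω, (k * (B b ω - B a ω)) * (B d ω - B c ω) ∂P =
      k * incrCov (2 * H) a b c d := by
    intro a b c d
    rw [← hB.integral_incr_mul_incr, ← integral_const_mul]
    congr 1 with ω
    ring
  have e2 : ∫ ω, (k * (B b ω - B a ω)) * (k * (B d ω - B c ω)) ∂P =
      k ^ 2 * incrCov (2 * H) a b c d := by
    rw [← hB.integral_incr_mul_incr, ← integral_const_mul]
    congr 1 with ω
    ring
  rw [HasGaussianLaw.integral_exp_neg_mul_sq_mul_mul (hB.hasGaussianLaw_incr k s t a b c d) ?_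
    (hB.integral_incr _ _ _) (hB.integral_incr _ _ _) (v := |(t : ℝ) - s| ^ (2 * H))
    (by positivity) ?_ hl, e1, e1, e2]
  · simpa using hB.integral_incr 1 s t
  · rw [← incrCov_self (by positivity), ← hB.integral_incr_mul_incr]
    simp only [sq]

end Scalar

/-! ### Independent components -/

section Vector

variable {Ω : Type*} [MeasurableSpace Ω] {P : Measure Ω} {n : ℕ} {H : ℝ}
  {X : ℝ≥0 → Ω → EuclideanSpace ℝ (Fin n)}

theorem IsFBMVec.integral_exp_neg_mul_sq_mul_mul (hX : IsFBMVec n H X P) (hH : 0 < H) {s t : ℝ≥0}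
    (hst : s ≠ t) (k : ℝ) (a b c d : ℝ≥0) {l : ℝ} (hl : 0 ≤ l) (i : Fin n) :
    ∫ ω, Real.exp (-l * ‖X t ω - X s ω‖ ^ 2) *
        ((k * (X b ω i - X a ω i)) * (k * (X d ω i - X c ω i))) ∂P =
      (1 + 2 * l * |(t : ℝ) - s| ^ (2 * H)) ^ (-((n : ℝ) / 2)) *
        (k ^ 2 * incrCov (2 * H) a b c d -
          (k * incrCov (2 * H) a b s t) * (k * incrCov (2 * H) c d s t) *
            (2 * l / (1 + 2 * l * |(t : ℝ) - s| ^ (2 * H)))) := by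
  classical
  set G := k ^ 2 * incrCov (2 * H) a b c d -
          (k * incrCov (2 * H) a b s t) * (k * incrCov (2 * H) c d s t) *
            (2 * l / (1 + 2 * l * |(t : ℝ) - s| ^ (2 * H)))
  set V := 1 + 2 * l * |(t : ℝ) - s| ^ (2 * H) with hV
  have hVpos : 0 < V := by positivity
  -- exp(-l|X_t - X_s|²) factors over the components, and only component i carries the increments.
  -- Each factor contributes the power -1/2, in total -n/2.
  let φ (j : Fin n) (x : ℝ≥0 → ℝ) : ℝ := Real.exp (-l * (x t - x s) ^ 2) *
    if j = i then (k * (x b - x a)) * (k * (x d - x c)) else 1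
  have hφ : ∀ j, Measurable (φ j) := by
    intro j
    by_cases hj : j = i <;> simp only [φ, hj, if_true, if_false] <;> fun_prop
  have key := hX.indep.integral_fun_prod_comp (f := φ)
    (fun j ↦ (measurable_pi_lambda _ fun t ↦ (hX.isFBM j).measurable t).aemeasurable)
    (fun j ↦ (hφ j).aestronglyMeasurable)
  have hL : ∀ ω, ∏ j, φ j (fun t ↦ X t ω j) = Real.exp (-l * ‖X t ω - X s ω‖ ^ 2) *
        ((k * (X b ω i - X a ω i)) * (k * (X d ω i - X c ω i))) := by
    intro ω
    simp only [φ]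
    rw [Finset.prod_mul_distrib, Finset.prod_ite_eq' Finset.univ i, if_pos (Finset.mem_univ i),
      ← Real.exp_sum, EuclideanSpace.norm_sq_eq, Finset.mul_sum]
    simp
  have hR : ∀ j, ∫ ω, φ j (fun t ↦ X t ω j) ∂P = V ^ (-(1 / 2) : ℝ) * if j = i then G else 1 := by
    intro j
    by_cases hj : j = i
    · subst hj
      simp only [φ, if_true]
      exact (hX.isFBM j).integral_exp_neg_mul_sq_mul_mul hH hst k a b c d hl
    · simp only [φ, hj, if_false, mul_one]
      exact (hX.isFBM j).integral_exp_neg_mul_sq hH hst hl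
  simp only [hL, hR] at key
  rw [key, Finset.prod_mul_distrib, Finset.prod_ite_eq' Finset.univ i,
    if_pos (Finset.mem_univ i), Finset.prod_const, Finset.card_univ, Fintype.card_fin,
    ← Real.rpow_natCast, ← Real.rpow_mul hVpos.le]
  congr 2
  ring

end Vector

/-! ### Mean of the energy integrand with a Gaussian kernel -/

/-- A path starting at 0 is extended by freezing it at time 0; this turns times t - ε into max (t -
ε) 0 in all covariances. -/
theorem extendByZero_eq {E : Type*} [Zero E] {x : ℝ≥0 → E} (hx : x 0 = 0) (t : ℝ) :
    extendByZero x t = x t.toNNReal := by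
  unfold extendByZero
  split_ifs with h
  · rfl
  · rw [Real.toNNReal_of_nonpos (by linarith), hx]

theorem symmDiffQuot_apply {d : ℕ} {x : ℝ≥0 → EuclideanSpace ℝ (Fin d)} (hx : x 0 = 0)
    (ε t : ℝ) (i : Fin d) :
    symmDiffQuot x ε t i = (2 * ε)⁻¹ * (x (t + ε).toNNReal i - x (t - ε).toNNReal i) := by
  simp [symmDiffQuot, extendByZero_eq hx]

section Expectation

variable {Ω : Type*} [MeasurableSpace Ω] {P : Measure Ω} {n : ℕ} {H : ℝ}
  {X : ℝ≥0 → Ω → EuclideanSpace ℝ (Fin n)}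

theorem IsFBMVec.measurable (hX : IsFBMVec n H X P) (t : ℝ≥0) : Measurable (X t) := by
  have h : Measurable fun ω (i : Fin n) ↦ X t ω i :=
    measurable_pi_lambda _ fun i ↦ (hX.isFBM i).measurable t
  exact (WithLp.measurable_toLp 2 (Fin n → ℝ)).comp h

theorem IsFBMVec.memLp_symmDiffQuot (hX : IsFBMVec n H X P) (h0 : ∀ ω, X 0 ω = 0) (ε t : ℝ)
    (i : Fin n) : MemLp (fun ω ↦ symmDiffQuot (fun t ↦ X t ω) ε t i) 2 P := by
  have e : (fun ω ↦ symmDiffQuot (fun t ↦ X t ω) ε t i) = fun ω ↦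
      (2 * ε)⁻¹ * (X (t + ε).toNNReal ω i - X (t - ε).toNNReal ω i) := by
    ext ω
    exact symmDiffQuot_apply (h0 ω) ε t i
  rw [e]
  exact (((hX.isFBM i).memLp_two _).sub ((hX.isFBM i).memLp_two _)).const_mul _

theorem IsFBMVec.integrable_exp_mul_symmDiffQuot (hX : IsFBMVec n H X P)
    (h0 : ∀ ω, X 0 ω = 0) (ε t s t' s' : ℝ) {l : ℝ} (hl : 0 ≤ l) (i : Fin n) :
    Integrable (fun ω ↦ Real.exp (-l *
      ‖extendByZero (fun t ↦ X t ω) t - extendByZero (fun t ↦ X t ω) s‖ ^ 2) *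
        (symmDiffQuot (fun t ↦ X t ω) ε t' i * symmDiffQuot (fun t ↦ X t ω) ε s' i)) P := by
  refine integrable_exp_neg_mul_sq_mul ?_
    ((hX.memLp_symmDiffQuot h0 ε t' i).integrable_mul (hX.memLp_symmDiffQuot h0 ε s' i)) hl
  have e0 : ∀ ω u, extendByZero (fun t ↦ X t ω) u = X u.toNNReal ω := fun ω u ↦
    extendByZero_eq (x := fun t ↦ X t ω) (h0 ω) u
  simp only [e0]
  exact (((hX.measurable _).sub (hX.measurable _)).norm).aemeasurable

theorem IsFBMVec.integral_exp_mul_symmDiffQuot (hX : IsFBMVec n H X P) (hH : 0 < H)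
    (h0 : ∀ ω, X 0 ω = 0) {ε t s t' s' r : ℝ} (hε : 0 < ε) (ht : 0 ≤ t) (hs : 0 ≤ s)
    (hts : t ≠ s) (ht' : 0 ≤ t') (hs' : 0 ≤ s') (hr : 0 < r) (i : Fin n) :
    ∫ ω, Real.exp (-(4 * r)⁻¹ *
      ‖extendByZero (fun t ↦ X t ω) t - extendByZero (fun t ↦ X t ω) s‖ ^ 2) *
        (symmDiffQuot (fun t ↦ X t ω) ε t' i * symmDiffQuot (fun t ↦ X t ω) ε s' i) ∂P =
      (1 + (2 * r)⁻¹ * |t - s| ^ (2 * H)) ^ (-((n : ℝ) / 2)) *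
        (quotCov (2 * H) ε t' s' -
          (incrCov (2 * H) (max (t' - ε) 0) (t' + ε) s t / (2 * ε)) *
          (incrCov (2 * H) (max (s' - ε) 0) (s' + ε) s t / (2 * ε)) *
            ((2 * r)⁻¹ / (1 + (2 * r)⁻¹ * |t - s| ^ (2 * H)))) := by
  have hst : s.toNNReal ≠ t.toNNReal := fun h ↦
    hts ((Real.toNNReal_eq_toNNReal_iff hs ht).1 h).symm
  have key := hX.integral_exp_neg_mul_sq_mul_mul hH hst (2 * ε)⁻¹ (t' - ε).toNNReal
    (t' + ε).toNNReal (s' - ε).toNNReal (s' + ε).toNNReal (l := (4 * r)⁻¹) (by positivity) i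
  have e0 : ∀ ω u, extendByZero (fun t ↦ X t ω) u = X u.toNNReal ω := fun ω u ↦
    extendByZero_eq (x := fun t ↦ X t ω) (h0 ω) u
  have e1 : ∀ ω u, symmDiffQuot (fun t ↦ X t ω) ε u i =
      (2 * ε)⁻¹ * (X (u + ε).toNNReal ω i - X (u - ε).toNNReal ω i) := fun ω u ↦
    symmDiffQuot_apply (x := fun t ↦ X t ω) (h0 ω) ε u i
  simp only [e0, e1]
  rw [key]
  have e : 2 * (4 * r)⁻¹ = (2 * r)⁻¹ := by field_simp; norm_num
  simp only [Real.coe_toNNReal', e, max_eq_left hs, max_eq_left ht,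
    max_eq_left (by linarith : 0 ≤ t' + ε), max_eq_left (by linarith : 0 ≤ s' + ε), quotCov]
  congr 2
  · ring
  · ring

theorem IsFBMVec.integral_exp_mul_symmDiffQuot_self_le (hX : IsFBMVec n H X P) (hH : 0 < H)
    (hCS : IncrCovBound (2 * H))
    (h0 : ∀ ω, X 0 ω = 0) {ε t s t' r : ℝ} (hε : 0 < ε) (ht : 0 ≤ t) (hs : 0 ≤ s)
    (hts : t ≠ s) (ht' : 0 ≤ t') (hr : 0 < r) (i : Fin n) :
    ∫ ω, Real.exp (-(4 * r)⁻¹ *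
      ‖extendByZero (fun t ↦ X t ω) t - extendByZero (fun t ↦ X t ω) s‖ ^ 2) *
        (symmDiffQuot (fun t ↦ X t ω) ε t' i * symmDiffQuot (fun t ↦ X t ω) ε t' i) ∂P ≤
      (1 + (2 * r)⁻¹ * |t - s| ^ (2 * H)) ^ (-((n : ℝ) / 2)) * (2 * ε) ^ (2 * H - 2) := by
  rw [hX.integral_exp_mul_symmDiffQuot hH h0 hε ht hs hts ht' ht' hr i]
  refine mul_le_mul_of_nonneg_left ?_ (by positivity)
  have h1 := (le_abs_self _).trans (hCS.abs_quotCov_le_rpow (by positivity) hε ht' ht')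
  have h2 : 0 ≤ (2 * r)⁻¹ / (1 + (2 * r)⁻¹ * |t - s| ^ (2 * H)) := by positivity
  have h3 := mul_nonneg
    (mul_self_nonneg (incrCov (2 * H) (max (t' - ε) 0) (t' + ε) s t / (2 * ε))) h2
  linarith

theorem inner_symmDiffQuot {d : ℕ} (x : ℝ≥0 → EuclideanSpace ℝ (Fin d)) (ε t s : ℝ) :
    inner ℝ (symmDiffQuot x ε t) (symmDiffQuot x ε s) =
      ∑ i, symmDiffQuot x ε t i * symmDiffQuot x ε s i := by
  rw [PiLp.inner_apply]
  refine Finset.sum_congr rfl fun i _ ↦ ?_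
  simp [mul_comm]

/-- The integrand of the energy with the Bessel kernel replaced by a Gaussian. -/
def gaussEnergyIntegrand {d : ℕ} (ε : ℝ) (x : ℝ≥0 → EuclideanSpace ℝ (Fin d)) (t s r : ℝ) : ℝ :=
  Real.exp (-(4 * r)⁻¹ * ‖extendByZero x t - extendByZero x s‖ ^ 2) *
    inner ℝ (symmDiffQuot x ε t) (symmDiffQuot x ε s)

theorem IsFBMVec.integrable_gaussEnergyIntegrand (hX : IsFBMVec n H X P)
    (h0 : ∀ ω, X 0 ω = 0) {ε t s r : ℝ} (hr : 0 < r) :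
    Integrable (fun ω ↦ gaussEnergyIntegrand ε (fun t ↦ X t ω) t s r) P := by
  simp only [gaussEnergyIntegrand, inner_symmDiffQuot, Finset.mul_sum]
  exact integrable_finsetSum _ fun i _ ↦
    hX.integrable_exp_mul_symmDiffQuot h0 ε t s t s (by positivity) i

theorem IsFBMVec.integral_gaussEnergyIntegrand (hX : IsFBMVec n H X P) (hH : 0 < H)
    (h0 : ∀ ω, X 0 ω = 0) {ε t s r : ℝ} (hε : 0 < ε) (ht : 0 ≤ t) (hs : 0 ≤ s)
    (hts : t ≠ s) (hr : 0 < r) :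
    ∫ ω, gaussEnergyIntegrand ε (fun t ↦ X t ω) t s r ∂P =
      n * ((1 + (2 * r)⁻¹ * |t - s| ^ (2 * H)) ^ (-((n : ℝ) / 2)) *
        (quotCov (2 * H) ε t s + quotIncrCov (2 * H) ε t s * quotIncrCov (2 * H) ε s t *
            ((2 * r)⁻¹ / (1 + (2 * r)⁻¹ * |t - s| ^ (2 * H))))) := by
  simp only [gaussEnergyIntegrand, inner_symmDiffQuot, Finset.mul_sum]
  rw [integral_finsetSum _ fun i _ ↦
    hX.integrable_exp_mul_symmDiffQuot h0 ε t s t s (by positivity) i]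
  simp only [hX.integral_exp_mul_symmDiffQuot hH h0 hε ht hs hts ht hs hr]
  rw [Finset.sum_const, Finset.card_univ, Fintype.card_fin, nsmul_eq_mul]
  -- `quotIncrCov` at (s, t) uses the increment from t to s, so reversing it turns the minus sign of
  -- the regression formula into a plus.
  have e : incrCov (2 * H) (max (s - ε) 0) (s + ε) s t / (2 * ε) = -quotIncrCov (2 * H) ε s t := by
    unfold quotIncrCov
    rw [incrCov_swap_right]
    ring
  have e' : incrCov (2 * H) (max (t - ε) 0) (t + ε) s t / (2 * ε) = quotIncrCov (2 * H) ε t s := rfl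
  rw [e, e']
  ring

/-- From |ab| ≤ (a² + b²)/2; for squares the regression correction has a favourable sign and is
dropped. The bound blows up as ε → 0 and serves only to justify Fubini. -/
theorem IsFBMVec.integral_abs_gaussEnergyIntegrand_le (hX : IsFBMVec n H X P) (hH : 0 < H)
    (hCS : IncrCovBound (2 * H)) (h0 : ∀ ω, X 0 ω = 0) {ε t s r : ℝ} (hε : 0 < ε) (ht : 0 ≤ t)
    (hs : 0 ≤ s) (hts : t ≠ s) (hr : 0 < r) :
    ∫ ω, |gaussEnergyIntegrand ε (fun t ↦ X t ω) t s r| ∂P ≤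
      n * ((1 + (2 * r)⁻¹ * |t - s| ^ (2 * H)) ^ (-((n : ℝ) / 2)) * (2 * ε) ^ (2 * H - 2)) := by
  set G : ℝ → Fin n → Ω → ℝ := fun t' i ω ↦ Real.exp (-(4 * r)⁻¹ *
      ‖extendByZero (fun t ↦ X t ω) t - extendByZero (fun t ↦ X t ω) s‖ ^ 2) *
        (symmDiffQuot (fun t ↦ X t ω) ε t' i * symmDiffQuot (fun t ↦ X t ω) ε t' i) with hG
  have iG : ∀ t' i, Integrable (G t' i) P := fun t' i ↦
    hX.integrable_exp_mul_symmDiffQuot h0 ε t s t' t' (by positivity) i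
  have iG2 : ∀ i, Integrable (fun ω ↦ (G t i ω + G s i ω) / 2) P := fun i ↦
    ((iG t i).add (iG s i)).div_const 2
  calc ∫ ω, |gaussEnergyIntegrand ε (fun t ↦ X t ω) t s r| ∂P
      ≤ ∫ ω, ∑ i, (G t i ω + G s i ω) / 2 ∂P := by
        refine integral_mono (hX.integrable_gaussEnergyIntegrand h0 hr).abs
          (integrable_finsetSum _ fun i _ ↦ iG2 i) fun ω ↦ ?_
        simp only [gaussEnergyIntegrand, inner_symmDiffQuot, Finset.mul_sum]
        refine (Finset.abs_sum_le_sum_abs _ _).trans (Finset.sum_le_sum fun i _ ↦ ?_)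
        rw [abs_mul, abs_of_pos (Real.exp_pos _)]
        simp only [hG]
        rw [← mul_add, mul_div_assoc]
        refine mul_le_mul_of_nonneg_left ?_ (Real.exp_pos _).le
        rw [abs_le]
        set x := symmDiffQuot (fun t ↦ X t ω) ε t i
        set y := symmDiffQuot (fun t ↦ X t ω) ε s i
        constructor <;> nlinarith [sq_nonneg (x - y), sq_nonneg (x + y)]
    _ = ∑ i, ((∫ ω, G t i ω ∂P) + ∫ ω, G s i ω ∂P) / 2 := by
        rw [integral_finsetSum _ fun i _ ↦ iG2 i]
        refine Finset.sum_congr rfl fun i _ ↦ ?_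
        rw [integral_div, integral_add (iG t i) (iG s i)]
    _ ≤ ∑ i : Fin n, (1 + (2 * r)⁻¹ * |t - s| ^ (2 * H)) ^ (-((n : ℝ) / 2)) *
          (2 * ε) ^ (2 * H - 2) := by
        refine Finset.sum_le_sum fun i _ ↦ ?_
        have h1 := hX.integral_exp_mul_symmDiffQuot_self_le hH hCS h0 hε ht hs hts ht hr i
        have h2 := hX.integral_exp_mul_symmDiffQuot_self_le hH hCS h0 hε ht hs hts hs hr i
        linarith
    _ = _ := by
        rw [Finset.sum_const, Finset.card_univ, Fintype.card_fin, nsmul_eq_mul]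

/-- Joint measurability in (ω, t) comes from continuity of every path, which is why an everywhere
continuous version is used. -/
theorem IsFBMVec.measurable_gaussEnergyIntegrand (hX : IsFBMVec n H X P)
    (h0 : ∀ ω, X 0 ω = 0) (hc : ∀ ω, Continuous fun t ↦ X t ω) (ε : ℝ) :
    Measurable fun q : Ω × ((ℝ × ℝ) × ℝ) ↦
      gaussEnergyIntegrand ε (fun t ↦ X t q.1) q.2.1.1 q.2.1.2 q.2.2 := by
  have hu := measurable_uncurry_of_continuous_of_measurable (u := X) hc hX.measurable
  have hE : ∀ f : Ω × ((ℝ × ℝ) × ℝ) → ℝ, Measurable f →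
      Measurable fun q : Ω × ((ℝ × ℝ) × ℝ) ↦ X (f q).toNNReal q.1 := fun f hf ↦
    hu.comp (hf.real_toNNReal.prodMk measurable_fst)
  have e0 : ∀ ω u, extendByZero (fun t ↦ X t ω) u = X u.toNNReal ω := fun ω u ↦
    extendByZero_eq (x := fun t ↦ X t ω) (h0 ω) u
  simp only [gaussEnergyIntegrand, symmDiffQuot, e0]
  have m1 := hE (fun q ↦ q.2.1.1) (by fun_prop)
  have m2 := hE (fun q ↦ q.2.1.2) (by fun_prop)
  have m3 := hE (fun q ↦ q.2.1.1 + ε) (by fun_prop)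
  have m4 := hE (fun q ↦ q.2.1.1 - ε) (by fun_prop)
  have m5 := hE (fun q ↦ q.2.1.2 + ε) (by fun_prop)
  have m6 := hE (fun q ↦ q.2.1.2 - ε) (by fun_prop)
  have m7 : Measurable fun q : Ω × ((ℝ × ℝ) × ℝ) ↦
      X (q.2.1.1 + ε).toNNReal q.1 - X (q.2.1.1 - ε).toNNReal q.1 := m3.sub m4
  have m8 : Measurable fun q : Ω × ((ℝ × ℝ) × ℝ) ↦
      X (q.2.1.2 + ε).toNNReal q.1 - X (q.2.1.2 - ε).toNNReal q.1 := m5.sub m6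
  refine Measurable.mul ?_ (Measurable.inner (𝕜 := ℝ)
    (m7.const_smul (2 * ε)⁻¹) (m8.const_smul (2 * ε)⁻¹))
  refine Real.measurable_exp.comp (Measurable.mul (by fun_prop) ((m1.sub m2).norm.pow_const 2))

end Expectation

/-! ### The majorant uniform in ε -/

/-- An integrable majorant for the covariances in the mean energy, uniform in `ε`. -/
def energyMajorant (p θ : ℝ) (z : ℝ × ℝ) : ℝ :=
  22 * |z.1 - z.2| ^ (p * θ + (p - 2)) +
    if p < 1 then z.1 ^ (2 * p - 2) * |z.1 - z.2| ^ (p * θ - p) +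
      z.2 ^ (2 * p - 2) * |z.1 - z.2| ^ (p * θ - p) else 0

/-- pθ > 1 - p makes the diagonal exponents exceed -1; p > 1/2 does the same for 2p - 2 at the axes.
-/
theorem integrableOn_energyMajorant {p θ T : ℝ} (hp : 1 / 2 < p) (hθ : 1 - p < p * θ)
    (hT : 0 < T) : IntegrableOn (energyMajorant p θ) (Icc 0 T ×ˢ Icc 0 T) := by
  unfold energyMajorant
  have h1 := (integrableOn_abs_sub_rpow (r := p * θ + (p - 2)) (by linarith) hT).const_mul 22
  split_ifs with h
  · exact h1.add ((integrableOn_rpow_fst_mul_abs_sub_rpow (by linarith) (by linarith) hT).add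
      (integrableOn_rpow_snd_mul_abs_sub_rpow (by linarith) (by linarith) hT))
  · simp only [add_zero]
    exact h1

theorem IncrCovBound.rpow_mul_abs_add_le {p θ ε t s : ℝ} (hCS : IncrCovBound p) (hp : 0 < p)
    (hp2 : p ≤ 2) (hε : 0 < ε) (ht : 0 < t) (hs : 0 < s) (hts : t ≠ s) :
    |t - s| ^ (p * θ) * (|quotCov p ε t s| +
      |quotIncrCov p ε t s * quotIncrCov p ε s t| * |t - s| ^ (-p)) ≤
      energyMajorant p θ (t, s) := by
  have h1 := hCS.abs_quotCov_le hp hp2 hε ht.le hs.le hts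
  have h2 := hCS.abs_quotIncrCov_le hp hp2 hε ht hs.le hts
  have h3 := hCS.abs_quotIncrCov_le hp hp2 hε hs ht.le hts.symm
  rw [abs_sub_comm s t] at h3
  have hu : 0 < |t - s| := abs_pos.2 (sub_ne_zero.2 hts)
  unfold energyMajorant
  simp only
  set u := |t - s|
  have e1 : u ^ (p * θ) * u ^ (p - 2) = u ^ (p * θ + (p - 2)) := (Real.rpow_add hu _ _).symm
  have e2 : u ^ (p * θ) * u ^ (-p) = u ^ (p * θ - p) := by
    rw [← Real.rpow_add hu]; rfl
  have e3 : u ^ (p * θ - p) * (u ^ (p - 1)) ^ 2 = u ^ (p * θ + (p - 2)) := by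
    rw [sq, ← Real.rpow_add hu, ← Real.rpow_add hu]
    ring_nf
  have sqpow : ∀ x : ℝ, 0 < x → (x ^ (p - 1)) ^ 2 = x ^ (2 * p - 2) := by
    intro x hx
    rw [sq, ← Real.rpow_add hx]
    ring_nf
  -- Young's inequality removes the cross terms. The 18, with the 4 from γ, makes the 22 of the
  -- majorant.
  have key : ∀ a x y : ℝ, 0 ≤ a → 0 ≤ x → 0 ≤ y → |quotIncrCov p ε t s| ≤ 3 * a + x →
      |quotIncrCov p ε s t| ≤ 3 * a + y →
      |quotIncrCov p ε t s * quotIncrCov p ε s t| ≤ 18 * a ^ 2 + (x ^ 2 + y ^ 2) := by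
    intro a x y ha hx hy i j
    rw [abs_mul]
    calc _ ≤ (3 * a + x) * (3 * a + y) := by gcongr
      _ ≤ _ := by nlinarith [sq_nonneg (3 * a - x), sq_nonneg (3 * a - y), sq_nonneg (x - y)]
  have hA : 0 < u ^ (p * θ) := Real.rpow_pos_of_pos hu _
  have hB : 0 < u ^ (-p) := Real.rpow_pos_of_pos hu _
  have hprod : |quotIncrCov p ε t s * quotIncrCov p ε s t| ≤ 18 * (u ^ (p - 1)) ^ 2 +
      if p < 1 then t ^ (2 * p - 2) + s ^ (2 * p - 2) else 0 := by
    split_ifs at h2 h3 ⊢ with h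
    · have := key (u ^ (p - 1)) (t ^ (p - 1)) (s ^ (p - 1)) (by positivity) (by positivity)
        (by positivity) h2 h3
      rwa [sqpow t ht, sqpow s hs] at this
    · simpa using key (u ^ (p - 1)) 0 0 (by positivity) le_rfl le_rfl h2 h3
  calc _ ≤ u ^ (p * θ) * (4 * u ^ (p - 2) + (18 * (u ^ (p - 1)) ^ 2 +
      if p < 1 then t ^ (2 * p - 2) + s ^ (2 * p - 2) else 0) * u ^ (-p)) := by gcongr
    _ = 4 * (u ^ (p * θ) * u ^ (p - 2)) + 18 * ((u ^ (p * θ) * u ^ (-p)) * (u ^ (p - 1)) ^ 2) +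
      (u ^ (p * θ) * u ^ (-p)) * if p < 1 then t ^ (2 * p - 2) + s ^ (2 * p - 2) else 0 := by ring
    _ = _ := by
      rw [e1, e2, e3]
      split_ifs <;> ring

theorem ae_prod_ne : ∀ᵐ z : ℝ × ℝ, z.1 ≠ z.2 ∧ z.1 ≠ 0 ∧ z.2 ≠ 0 := by
  have h : ∀ᵐ x : ℝ, x ≠ 0 := by simp [ae_iff]
  rw [Measure.volume_eq_prod]
  have h1 := (Measure.quasiMeasurePreserving_fst (μ := (volume : Measure ℝ))
    (ν := (volume : Measure ℝ))).ae h
  have h2 := (Measure.quasiMeasurePreserving_snd (μ := (volume : Measure ℝ))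
    (ν := (volume : Measure ℝ))).ae h
  have h3 := (quasiMeasurePreserving_sub_of_right_invariant (volume : Measure ℝ)
    (volume : Measure ℝ)).ae h
  filter_upwards [h1, h2, h3] with z a b c
  exact ⟨sub_ne_zero.1 c, a, b⟩

theorem ae_square_prod_Ioi (T : ℝ) :
    ∀ᵐ y : (ℝ × ℝ) × ℝ ∂((volume.restrict (Icc (0 : ℝ) T ×ˢ Icc (0 : ℝ) T)).prod
      (volume.restrict (Ioi (0 : ℝ)))), 0 < y.1.1 ∧ 0 < y.1.2 ∧ y.1.1 ≠ y.1.2 ∧ 0 < y.2 := by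
  have h1 : ∀ᵐ z : ℝ × ℝ ∂(volume.restrict (Icc (0 : ℝ) T ×ˢ Icc (0 : ℝ) T)),
      0 < z.1 ∧ 0 < z.2 ∧ z.1 ≠ z.2 := by
    filter_upwards [ae_restrict_of_ae ae_prod_ne,
      ae_restrict_mem (measurableSet_Icc.prod measurableSet_Icc)] with z hz hm
    exact ⟨lt_of_le_of_ne hm.1.1 hz.2.1.symm, lt_of_le_of_ne hm.2.1 hz.2.2.symm, hz.1⟩
  have h2 : ∀ᵐ r : ℝ ∂(volume.restrict (Ioi (0 : ℝ))), 0 < r := ae_restrict_mem measurableSet_Ioi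
  filter_upwards [Measure.quasiMeasurePreserving_fst.ae h1,
    Measure.quasiMeasurePreserving_snd.ae h2] with y a b
  exact ⟨a.1, a.2.1, a.2.2, b⟩

/-! ### Fubini and the uniform bound -/

section Energy

variable {Ω : Type*} [MeasurableSpace Ω] {P : Measure Ω} {n : ℕ} {H : ℝ}
  {X : ℝ≥0 → Ω → EuclideanSpace ℝ (Fin n)}

theorem rpow_inv_mul_abs_sub {p θ r u : ℝ} (hr : 0 < r) (hu : 0 ≤ u) :
    ((2 * r)⁻¹ * u ^ p) ^ θ = (2 * r) ^ (-θ) * u ^ (p * θ) := by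
  rw [Real.mul_rpow (by positivity) (by positivity), Real.inv_rpow (by positivity),
    ← Real.rpow_neg (by positivity), ← Real.rpow_mul hu]

/-- After subtraction of c times γ, both the γ-term and the regression term carry a factor O(x^θ),
and x^θ splits into a power of r times u^(pθ). -/
theorem IsFBMVec.abs_integral_gaussEnergyIntegrand_sub_le (hX : IsFBMVec n H X P) (hH : 0 < H)
    (hH1 : H ≤ 1) (hCS : IncrCovBound (2 * H)) (h0 : ∀ ω, X 0 ω = 0) {θ c C : ℝ}
    (hC : ∀ x : ℝ, 0 < x → |(1 + x) ^ (-((n : ℝ) / 2)) - c| ≤ C * x ^ θ ∧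
        (1 + x) ^ (-((n : ℝ) / 2)) * (x / (1 + x)) ≤ C * x ^ θ) (hC0 : 0 ≤ C)
    {ε t s r : ℝ} (hε : 0 < ε) (ht : 0 < t) (hs : 0 < s) (hts : t ≠ s) (hr : 0 < r) :
    |∫ ω, gaussEnergyIntegrand ε (fun t ↦ X t ω) t s r ∂P - n * c * quotCov (2 * H) ε t s| ≤
      n * C * ((2 * r) ^ (-θ) * energyMajorant (2 * H) θ (t, s)) := by
  have hu : 0 < |t - s| := abs_pos.2 (sub_ne_zero.2 hts)
  have hmaj := hCS.rpow_mul_abs_add_le (θ := θ) (by positivity) (by linarith) hε ht hs hts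
  rw [hX.integral_gaussEnergyIntegrand hH h0 hε ht.le hs.le hts hr]
  set p := 2 * H
  set x := (2 * r)⁻¹ * |t - s| ^ p with hx
  have hx0 : 0 < x := by positivity
  obtain ⟨c1, c2⟩ := hC x hx0
  have hxθ : x ^ θ = (2 * r) ^ (-θ) * |t - s| ^ (p * θ) := rpow_inv_mul_abs_sub hr (abs_nonneg _)
  set γ := quotCov p ε t s
  set κ := quotIncrCov p ε t s * quotIncrCov p ε s t
  set w := (1 + x) ^ (-((n : ℝ) / 2)) with hw
  have hw0 : 0 ≤ w := by positivity
  -- Trading (2r)⁻¹ for u^(-p) x produces the factor x/(1+x), to which the comparison applies.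
  have e1 : (2 * r)⁻¹ / (1 + x) = |t - s| ^ (-p) * (x / (1 + x)) := by
    rw [hx, Real.rpow_neg (abs_nonneg _)]
    have : |t - s| ^ p ≠ 0 := (Real.rpow_pos_of_pos hu _).ne'
    field_simp
  have hq : 0 ≤ x / (1 + x) := by positivity
  have hup : 0 ≤ |t - s| ^ (-p) := by positivity
  rw [e1]
  calc |n * (w * (γ + κ * (|t - s| ^ (-p) * (x / (1 + x))))) - n * c * γ|
      = n * |(w - c) * γ + κ * |t - s| ^ (-p) * (w * (x / (1 + x)))| := by
        rw [← abs_of_nonneg (Nat.cast_nonneg (α := ℝ) n), ← abs_mul,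
          abs_of_nonneg (Nat.cast_nonneg (α := ℝ) n)]
        congr 1
        ring
    _ ≤ n * (C * x ^ θ * |γ| + |κ| * |t - s| ^ (-p) * (C * x ^ θ)) := by
        gcongr
        refine (abs_add_le _ _).trans (add_le_add ?_ ?_)
        · rw [abs_mul]
          gcongr
        · rw [abs_mul, abs_mul, abs_of_nonneg hup, abs_of_nonneg (mul_nonneg hw0 hq)]
          gcongr
    _ = n * C * ((2 * r) ^ (-θ) * (|t - s| ^ (p * θ) * (|γ| + |κ| * |t - s| ^ (-p)))) := by
        rw [hxθ]
        ring
    _ ≤ _ := by gcongr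

theorem IsFBMVec.integrable_besselWeight_mul_gaussEnergyIntegrand [IsProbabilityMeasure P]
    (hX : IsFBMVec n H X P)
    (hH : 0 < H) (hH1 : H < 1) (hCS : IncrCovBound (2 * H)) (h0 : ∀ ω, X 0 ω = 0)
    (hc : ∀ ω, Continuous fun t ↦ X t ω) {α θ c C : ℝ}
    (hC : ∀ x : ℝ, 0 < x → |(1 + x) ^ (-((n : ℝ) / 2)) - c| ≤ C * x ^ θ)
    (hcα : c = 0 ∨ c = 1 ∧ 0 < α - (n : ℝ) / 2) (hθα : θ < α - (n : ℝ) / 2)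
    (hθ : 1 - 2 * H < 2 * H * θ) {ε T : ℝ} (hε : 0 < ε) (hT : 0 < T) :
    Integrable (fun q : Ω × ((ℝ × ℝ) × ℝ) ↦ besselWeight n α q.2.2 *
      gaussEnergyIntegrand ε (fun t ↦ X t q.1) q.2.1.1 q.2.1.2 q.2.2)
      (P.prod ((volume.restrict (Icc (0 : ℝ) T ×ˢ Icc (0 : ℝ) T)).prod
        (volume.restrict (Ioi (0 : ℝ))))) := by
  have hm : Measurable (fun q : Ω × ((ℝ × ℝ) × ℝ) ↦ besselWeight n α q.2.2 *
      gaussEnergyIntegrand ε (fun t ↦ X t q.1) q.2.1.1 q.2.1.2 q.2.2) :=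
    ((measurable_besselWeight n α).comp (by fun_prop)).mul
      (hX.measurable_gaussEnergyIntegrand h0 hc ε)
  rw [integrable_prod_iff' hm.aestronglyMeasurable]
  constructor
  · filter_upwards [ae_square_prod_Ioi T] with y hy
    exact (hX.integrable_gaussEnergyIntegrand h0 hy.2.2.2).const_mul _
  · have j1 : Integrable (fun z : ℝ × ℝ ↦ |z.1 - z.2| ^ (2 * H * θ))
        (volume.restrict (Icc (0 : ℝ) T ×ˢ Icc (0 : ℝ) T)) :=
      integrableOn_abs_sub_rpow (by linarith) hT
    have j2 : Integrable (fun _ : ℝ × ℝ ↦ (1 : ℝ))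
        (volume.restrict (Icc (0 : ℝ) T ×ˢ Icc (0 : ℝ) T)) := by
      have := integrableOn_abs_sub_rpow (r := 0) (by norm_num) hT
      simp only [Real.rpow_zero] at this
      exact this
    have g1 := j1.mul_prod (integrableOn_besselWeight_mul_rpow hθα)
    have g2 := j2.mul_prod (integrableOn_const_mul_besselWeight hcα)
    -- The majorant for fixed ε, from (1+x)^(-n/2) ≤ c + C x^θ.
    have g := ((g1.const_mul C).add g2).const_mul (n * (2 * ε) ^ (2 * H - 2))
    refine g.mono' hm.aestronglyMeasurable.norm.prod_swap.integral_prod_right' ?_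
    filter_upwards [ae_square_prod_Ioi T] with y hy
    obtain ⟨ht, hs, hts, hr⟩ := hy
    rw [Real.norm_eq_abs, abs_of_nonneg (integral_nonneg fun ω ↦ norm_nonneg _)]
    simp only [Real.norm_eq_abs, abs_mul,
      abs_of_nonneg (besselWeight_nonneg n α hr)]
    rw [integral_const_mul]
    have hle := hX.integral_abs_gaussEnergyIntegrand_le hH hCS h0 hε ht.le hs.le hts hr
    have hu : 0 < |y.1.1 - y.1.2| := abs_pos.2 (sub_ne_zero.2 hts)
    have hx0 : 0 < (2 * y.2)⁻¹ * |y.1.1 - y.1.2| ^ (2 * H) := by positivity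
    have h1 := (le_abs_self _).trans (hC _ hx0)
    rw [rpow_inv_mul_abs_sub hr (abs_nonneg _)] at h1
    have hw := besselWeight_nonneg n α hr
    have hpe : 0 ≤ (2 * ε) ^ (2 * H - 2) := by positivity
    simp only [Pi.add_apply]
    calc _ ≤ besselWeight n α y.2 *
          (n * ((c + C * ((2 * y.2) ^ (-θ) * |y.1.1 - y.1.2| ^ (2 * H * θ))) *
            (2 * ε) ^ (2 * H - 2))) := by
          refine mul_le_mul_of_nonneg_left (hle.trans ?_) hw
          gcongr
          linarith
      _ = _ := by ring

/-- This also holds where the kernel integral diverges: pulling out a constant factor respects the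
default value 0 of the integral. -/
theorem symmEnergyIntegrand_eq {d : ℕ} (α ε : ℝ) (x : ℝ≥0 → EuclideanSpace ℝ (Fin d))
    (z : ℝ × ℝ) :
    symmEnergyIntegrand α ε x z = (Real.Gamma α * (4 * Real.pi) ^ ((d : ℝ) / 2))⁻¹ *
      ∫ r in Ioi (0 : ℝ), besselWeight d α r * gaussEnergyIntegrand ε x z.1 z.2 r := by
  unfold symmEnergyIntegrand gaussEnergyIntegrand
  rw [besselKernel_eq, mul_assoc, ← integral_mul_const]
  congr 2 with r
  ring

theorem IsFBMVec.bddAbove_integral_symmEnergy_of_continuous [IsProbabilityMeasure P]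
    (hX : IsFBMVec n H X P) (hn : 1 ≤ n)
    (hH : 1 / 4 < H) (hH1 : H < 1) (h0 : ∀ ω, X 0 ω = 0)
    (hc : ∀ ω, Continuous fun t ↦ X t ω) {α T : ℝ}
    (hα : (n : ℝ) / 2 - 1 + 1 / (2 * H) < α) (hT : 0 < T) :
    (∀ ε : ℝ, 0 < ε →
      (∀ᵐ ω ∂P, IntegrableOn (symmEnergyIntegrand α ε fun t ↦ X t ω)
        (Icc (0 : ℝ) T ×ˢ Icc (0 : ℝ) T)) ∧
      Integrable (fun ω ↦ symmEnergy T α ε fun t ↦ X t ω) P) ∧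
    BddAbove ((fun ε : ℝ ↦ ∫ ω, symmEnergy T α ε (fun t ↦ X t ω) ∂P) '' Ioi (0 : ℝ)) := by
  have hH0 : 0 < H := by linarith
  have hCS : IncrCovBound (2 * H) := (hX.isFBM ⟨0, hn⟩).incrCovBound hH0
  obtain ⟨θ, c, C, hC0, hcα, hθα, hθ, hC⟩ :=
    exists_comparison_exponent hn (p := 2 * H) (by linarith) (by linarith) hα
  set μ := volume.restrict (Icc (0 : ℝ) T ×ˢ Icc (0 : ℝ) T) with hμ
  set ν := volume.restrict (Ioi (0 : ℝ)) with hν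
  set K := (Real.Gamma α * (4 * Real.pi) ^ ((n : ℝ) / 2))⁻¹ with hK
  set F : ℝ → Ω → (ℝ × ℝ) × ℝ → ℝ := fun ε ω y ↦ besselWeight n α y.2 *
      gaussEnergyIntegrand ε (fun t ↦ X t ω) y.1.1 y.1.2 y.2 with hF
  have iF : ∀ ε, 0 < ε → Integrable (fun q : Ω × ((ℝ × ℝ) × ℝ) ↦ F ε q.1 q.2)
      (P.prod (μ.prod ν)) := fun ε hε ↦
    hX.integrable_besselWeight_mul_gaussEnergyIntegrand hH0 hH1 hCS h0 hc
      (fun x hx ↦ (hC x hx).1) hcα hθα hθ hε hT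
  have hZ : ∀ ε, 0 < ε → (fun ω ↦ K * ∫ y, F ε ω y ∂(μ.prod ν)) =ᵐ[P]
      fun ω ↦ symmEnergy T α ε fun t ↦ X t ω := by
    intro ε hε
    filter_upwards [(iF ε hε).prod_right_ae] with ω hω
    rw [integral_prod _ hω, symmEnergy, ← integral_const_mul]
    congr 1 with z
    exact (symmEnergyIntegrand_eq α ε _ z).symm
  refine ⟨fun ε hε ↦ ⟨?_, ?_⟩, ?_⟩
  · filter_upwards [(iF ε hε).prod_right_ae] with ω hω
    have := hω.integral_prod_left.const_mul K
    refine this.congr (ae_of_all _ fun z ↦ ?_)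
    exact (symmEnergyIntegrand_eq α ε _ z).symm
  · exact ((iF ε hε).integral_prod_left.const_mul K).congr (hZ ε hε)
  · have g1 : Integrable (fun y : (ℝ × ℝ) × ℝ ↦ energyMajorant (2 * H) θ y.1 *
        (besselWeight n α y.2 * (2 * y.2) ^ (-θ))) (μ.prod ν) :=
      Integrable.mul_prod (integrableOn_energyMajorant (by linarith) hθ hT)
        (integrableOn_besselWeight_mul_rpow hθα)
    set A := ∫ y : (ℝ × ℝ) × ℝ, energyMajorant (2 * H) θ y.1 *
        (besselWeight n α y.2 * (2 * y.2) ^ (-θ)) ∂(μ.prod ν) with hA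
    set W := ∫ r, c * besselWeight n α r ∂ν with hW
    refine ⟨|K| * (n * C * A + n * (((2 * T) ^ (2 * H - 2) * T ^ 2 + 8 * (2 * T) ^ (2 * H)) * |W|)),
      ?_⟩
    rintro _ ⟨ε, hε, rfl⟩
    have hε : 0 < ε := hε
    have g2 : Integrable (fun y : (ℝ × ℝ) × ℝ ↦ quotCov (2 * H) ε y.1.1 y.1.2 *
        (c * besselWeight n α y.2)) (μ.prod ν) :=
      Integrable.mul_prod (f := fun z : ℝ × ℝ ↦ quotCov (2 * H) ε z.1 z.2)
        (g := fun r ↦ c * besselWeight n α r) (integrableOn_quotCov (by linarith) hε)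
        (integrableOn_const_mul_besselWeight hcα)
    have e2 : ∫ y : (ℝ × ℝ) × ℝ, quotCov (2 * H) ε y.1.1 y.1.2 *
        (c * besselWeight n α y.2) ∂(μ.prod ν) = (∫ z, quotCov (2 * H) ε z.1 z.2 ∂μ) * W :=
      integral_prod_mul (fun z : ℝ × ℝ ↦ quotCov (2 * H) ε z.1 z.2)
        (fun r ↦ c * besselWeight n α r)
    have hb := hCS.abs_integral_quotCov_le (by linarith) (by linarith) hε hT
    have iE : Integrable (fun y ↦ ∫ ω, F ε ω y ∂P) (μ.prod ν) := (iF ε hε).integral_prod_right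
    -- The part controlled in absolute value by the majorant; what was subtracted factors into the
    -- telescoping integral of γ times W.
    have hdiff : |∫ y, ((∫ ω, F ε ω y ∂P) - n * (quotCov (2 * H) ε y.1.1 y.1.2 *
        (c * besselWeight n α y.2))) ∂(μ.prod ν)| ≤ n * C * A := by
      rw [hA, ← integral_const_mul]
      refine (abs_integral_le_integral_abs).trans (integral_mono_ae
        (iE.sub (g2.const_mul _)).abs (g1.const_mul _) ?_)
      filter_upwards [ae_square_prod_Ioi T] with y hy
      obtain ⟨ht, hs, hts, hr⟩ := hy
      have hw := besselWeight_nonneg n α hr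
      have key := hX.abs_integral_gaussEnergyIntegrand_sub_le hH0 hH1.le hCS h0 hC hC0 hε ht hs
        hts hr
      simp only [hF]
      rw [integral_const_mul]
      calc _ = besselWeight n α y.2 *
            |∫ ω, gaussEnergyIntegrand ε (fun t ↦ X t ω) y.1.1 y.1.2 y.2 ∂P -
              n * c * quotCov (2 * H) ε y.1.1 y.1.2| := by
            rw [← abs_of_nonneg hw, ← abs_mul, abs_of_nonneg hw]
            congr 1
            ring
        _ ≤ _ := mul_le_mul_of_nonneg_left key hw
        _ = _ := by ring
    rw [integral_sub iE (g2.const_mul _), integral_const_mul, e2] at hdiff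
    simp only
    rw [← integral_congr_ae (hZ ε hε), integral_const_mul,
      integral_integral_swap (f := F ε) (iF ε hε)]
    refine (le_abs_self _).trans ?_
    rw [abs_mul]
    refine mul_le_mul_of_nonneg_left ?_ (abs_nonneg K)
    have h2 : |n * ((∫ z, quotCov (2 * H) ε z.1 z.2 ∂μ) * W)| ≤
        n * (((2 * T) ^ (2 * H - 2) * T ^ 2 + 8 * (2 * T) ^ (2 * H)) * |W|) := by
      rw [abs_mul, abs_mul, abs_of_nonneg (Nat.cast_nonneg (α := ℝ) n)]
      gcongr
    have h3 := abs_sub_abs_le_abs_sub (∫ y, ∫ ω, F ε ω y ∂P ∂(μ.prod ν))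
      (n * ((∫ z, quotCov (2 * H) ε z.1 z.2 ∂μ) * W))
    linarith

end Energy

/-! ### Reduction to continuous paths starting at 0 -/

section Modification

variable {Ω : Type*} [MeasurableSpace Ω] {P : Measure Ω}

theorem IsFBM.congr {H : ℝ} {B B' : ℝ≥0 → Ω → ℝ} (hB : IsFBM H B P)
    (hm : ∀ t, Measurable (B' t)) (h : ∀ᵐ ω ∂P, ∀ t, B t ω = B' t ω) : IsFBM H B' P where
  measurable := hm
  gaussian := hB.gaussian.congr fun t ↦ h.mono fun ω hω ↦ hω t
  mean_zero t := by
    rw [← hB.mean_zero t]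
    exact integral_congr_ae (h.mono fun ω hω ↦ (hω t).symm)
  covariance_eq s t := by
    rw [← hB.covariance_eq s t]
    have e : ∀ t, ∫ ω, B' t ω ∂P = ∫ ω, B t ω ∂P := fun t ↦
      integral_congr_ae (h.mono fun ω hω ↦ (hω t).symm)
    unfold covariance
    refine integral_congr_ae (h.mono fun ω hω ↦ ?_)
    simp only [e, hω]
  continuous_paths := by
    filter_upwards [h, hB.continuous_paths] with ω h1 h2
    simpa only [← h1] using h2

/-- The second moment at time 0 vanishes. -/
theorem IsFBM.ae_zero {H : ℝ} {B : ℝ≥0 → Ω → ℝ} (hB : IsFBM H B P) (hH : 0 < H) :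
    ∀ᵐ ω ∂P, B 0 ω = 0 := by
  have h := hB.integral_mul 0 0
  have hne : 2 * H ≠ 0 := by positivity
  simp only [NNReal.coe_zero, Real.zero_rpow hne, sub_zero, abs_zero, add_zero, mul_zero] at h
  rw [integral_eq_zero_iff_of_nonneg (fun ω ↦ mul_self_nonneg _)
    ((hB.memLp_two 0).integrable_mul (hB.memLp_two 0))] at h
  filter_upwards [h] with ω hω
  exact mul_self_eq_zero.1 hω

/-- A fractional Brownian motion is indistinguishable from one that starts at `0` and has
continuous paths everywhere. -/
theorem IsFBMVec.exists_continuous {d : ℕ} {H : ℝ} {X : ℝ≥0 → Ω → EuclideanSpace ℝ (Fin d)}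
    (hX : IsFBMVec d H X P) (hH : 0 < H) :
    ∃ Y : ℝ≥0 → Ω → EuclideanSpace ℝ (Fin d), IsFBMVec d H Y P ∧ (∀ ω, Y 0 ω = 0) ∧
      (∀ ω, Continuous fun t ↦ Y t ω) ∧ ∀ᵐ ω ∂P, (fun t ↦ X t ω) = fun t ↦ Y t ω := by
  classical
  have hgood : ∀ᵐ ω ∂P, (∀ i : Fin d, Continuous fun t ↦ X t ω i) ∧ X 0 ω = 0 := by
    have h1 := ae_all_iff.2 fun i ↦ (hX.isFBM i).continuous_paths
    have h2 := ae_all_iff.2 fun i ↦ (hX.isFBM i).ae_zero hH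
    filter_upwards [h1, h2] with ω a b
    refine ⟨a, ?_⟩
    ext i
    exact b i
  -- The bad set need not be measurable; a measurable null superset N is needed so that setting the
  -- paths to 0 on N keeps each Y t measurable.
  obtain ⟨N, hNsub, hNm, hN0⟩ := exists_measurable_superset_of_null (ae_iff.1 hgood)
  have hNc : ∀ ω, ω ∉ N → (∀ i : Fin d, Continuous fun t ↦ X t ω i) ∧ X 0 ω = 0 := by
    intro ω hω
    by_contra h
    exact hω (hNsub h)
  have hae : ∀ᵐ ω ∂P, ω ∉ N := measure_eq_zero_iff_ae_notMem.1 hN0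
  set Y : ℝ≥0 → Ω → EuclideanSpace ℝ (Fin d) := fun t ↦ Nᶜ.indicator (X t) with hY
  have hYX : ∀ ω, ω ∉ N → ∀ t, X t ω = Y t ω := fun ω hω t ↦
    (indicator_of_mem (show ω ∈ Nᶜ from hω) _).symm
  have hY0 : ∀ ω, ω ∈ N → ∀ t, Y t ω = 0 := fun ω hω t ↦
    indicator_of_notMem (show ω ∉ Nᶜ from fun h ↦ h hω) _
  have hYm : ∀ t, Measurable (Y t) := fun t ↦ (hX.measurable t).indicator hNm.compl
  refine ⟨Y, ⟨fun i ↦ ?_, ?_⟩, fun ω ↦ ?_, fun ω ↦ ?_, ?_⟩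
  · refine (hX.isFBM i).congr (fun t ↦ ?_) (hae.mono fun ω hω t ↦ by rw [hYX ω hω t])
    exact (measurable_pi_apply i).comp ((WithLp.measurable_ofLp 2 (Fin d → ℝ)).comp (hYm t))
  · exact hX.indep.congr fun i ↦ hae.mono fun ω hω ↦ funext fun t ↦ by
      simp only [hYX ω hω t]
  · by_cases hω : ω ∈ N
    · exact hY0 ω hω 0
    · rw [← hYX ω hω 0]
      exact (hNc ω hω).2
  · by_cases hω : ω ∈ N
    · simp only [hY0 ω hω]
      exact continuous_const
    · simp only [← hYX ω hω]
      exact (PiLp.continuous_toLp 2 _).comp (continuous_pi (hNc ω hω).1)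
  · exact hae.mono fun ω hω ↦ funext (hYX ω hω)

end Modification

end

theorem mainTheorem3 {Ω : Type*} [MeasurableSpace Ω] (P : Measure Ω) [IsProbabilityMeasure P]
    (d : ℕ) (hd : 1 ≤ d) (H : ℝ) (hH : 1 / 4 < H) (hH1 : H < 1) (T : ℝ) (hT : 0 < T)
    (X : ℝ≥0 → Ω → EuclideanSpace ℝ (Fin d)) (hX : IsFBMVec d H X P)
    (α : ℝ) (hα : (d : ℝ) / 2 - 1 + 1 / (2 * H) < α) :
    (∀ ε : ℝ, 0 < ε →
      (∀ᵐ ω ∂P, IntegrableOn (symmEnergyIntegrand α ε fun t ↦ X t ω)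
        (Icc (0 : ℝ) T ×ˢ Icc (0 : ℝ) T)) ∧
      Integrable (fun ω ↦ symmEnergy T α ε fun t ↦ X t ω) P) ∧
    BddAbove ((fun ε : ℝ ↦ ∫ ω, symmEnergy T α ε (fun t ↦ X t ω) ∂P) '' Ioi (0 : ℝ)) := by
  obtain ⟨Y, hY, hY0, hYc, hXY⟩ := hX.exists_continuous (by linarith)
  obtain ⟨h1, h2⟩ := hY.bddAbove_integral_symmEnergy_of_continuous hd hH hH1 hY0 hYc hα hT
  have hZ : ∀ ε, (fun ω ↦ symmEnergy T α ε fun t ↦ Y t ω) =ᵐ[P]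
      fun ω ↦ symmEnergy T α ε fun t ↦ X t ω := fun ε ↦ hXY.mono fun ω hω ↦ by
    simp only [hω]
  refine ⟨fun ε hε ↦ ⟨?_, (h1 ε hε).2.congr (hZ ε)⟩, ?_⟩
  · filter_upwards [(h1 ε hε).1, hXY] with ω a b
    rwa [b]
  · simpa only [integral_congr_ae (hZ _)] using h2
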